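/- Let $d\in\{2,3\}$, $\kappa\in\mathbb R$ and $N\in\mathbb N$. There is a constant $C>0$, depending only on $d$, $\kappa$ and $N$, such that the following holds. **Setting.** Let $\mathcal T^*$ be a finite conforming mesh of nondegenerate closed $d$-simplices in $\mathbb R^d$, and let $\Omega^*=\bigcup_{T\in\mathcal T^*}T$. Suppose $\mathcal T^*$ is shape regular with parameter $\kappa$: every $T$ contains a ball of some radius $\rho>0$ with $h_T\le\kappa\rho$, where $h_T=\operatorname{diam}T$. Let $\Omega\subset\Omega^*$ be open with boundary $\Gamma=\partial\Omega$, and suppose $T\cap\Omega\ne\emptyset$ for all $T\in\mathcal T^*$. A facet (a $(d-1)$-dimensional face of a cell) is *interior* if it is shared by two cells $T_F^+,T_F^-$. For an interior facet, $h_F$ is the average of the diameters of these two cells and $n=n_F$ is an arbitrary fixed unit normal of $F$. Also $\partial_n v=n\cdot\nabla v$ and $[v]=v^+-v^-$ on $F$, where $v^\pm(x)=\lim_{t\to0^+}v(x\pm tn)$. Let $\mathcal T^*_\Gamma$ be the set of cells that meet $\Gamma$ (the cut cells), and let $\mathcal F^*_\Gamma$ be the set of interior facets belonging to at least one cut cell.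 Assume (G3) for every $T\in\mathcal T^*_\Gamma$ there are at most $N$ cells $T_1=T,T_2,\dots,T_m$ ($m\le N$) of $\mathcal T^*$ such that $T_m\notin\mathcal T^*_\Gamma$ and each $T_i\cap T_{i+1}$ is an interior facet. No regularity of $\Gamma$, and no further condition on how $\Gamma$ cuts the mesh, is assumed. Below, $\|\cdot\|_D$ is the $L^2(D)$ norm, $\|\cdot\|_F$ is the $L^2$ norm on $F$ with respect to surface measure, and $|\nabla v|$ is the Frobenius norm. **Conclusion.** 1. For every continuous $v_h:\Omega^*\to\mathbb R^d$ that is affine on each cell, $$\|\nabla v_h\|_{\Omega^*}^2\le C\Big(\|\nabla v_h\|_\Omega^2+\sum_{F\in\mathcal F^*_\Gamma}h_F\|[\partial_n v_h]\|_F^2\Big),\qquad \|\nabla v_h\|_\Omega^2+\sum_{F\in\mathcal F^*_\Gamma}h_F\|[\partial_n v_h]\|_F^2\le C\|\nabla v_h\|_{\Omega^*}^2 .$$ 2. For every (discontinuous) scalar function $q_h$ that is constant on the interior of each cell, $$\|q_h\|_{\Omega^*}^2\le C\Big(\|q_h\|_\Omega^2+\sum_{F\in\mathcal F^*_\Gamma}h_F\|[q_h]\|_F^2\Big),\qquad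 \|q_h\|_\Omega^2+\sum_{F\in\mathcal F^*_\Gamma}h_F\|[q_h]\|_F^2\le C\|q_h\|_{\Omega^*}^2 .$$ 3. For every continuous scalar function $q_h$ that is affine on each cell, $$\|q_h\|_{\Omega^*}^2\le C\Big(\|q_h\|_\Omega^2+\sum_{F\in\mathcal F^*_\Gamma}h_F^3\|[\partial_n q_h]\|_F^2\Big),\qquad \|q_h\|_\Omega^2+\sum_{F\in\mathcal F^*_\Gamma}h_F^3\|[\partial_n q_h]\|_F^2\le C\|q_h\|_{\Omega^*}^2 .$$ In particular, $C$ is independent of the mesh size and of the position of $\Gamma$ relative to the mesh. -/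

import Mathlib

open MeasureTheory Topology

namespace FictitiousDomain

/-- The ambient Euclidean space `ℝᵈ`. -/
abbrev Pt (d : ℕ) : Type := EuclideanSpace ℝ (Fin d)

/-- A conforming tessellation by finitely many nondegenerate closed `d`-simplices. A cell is
represented by the finite set of its `d + 1` vertices; the closed simplex itself is the convex hull
of that set. Two cells meet in the convex hull of their common vertices. -/
structure Mesh (d : ℕ) where
  cells : Finset (Finset (Pt d))
  card_eq : ∀ T ∈ cells, T.card = d + 1
  indep : ∀ T ∈ cells, AffineIndependent ℝ ((↑) : T → Pt d)
  conforming : ∀ S ∈ cells, ∀ T ∈ cells,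
    convexHull ℝ (S : Set (Pt d)) ∩ convexHull ℝ (T : Set (Pt d)) ⊆
      convexHull ℝ ((S : Set (Pt d)) ∩ (T : Set (Pt d)))

/-- The closed simplex spanned by a finite set of vertices (used for cells and for facets). -/
def hull {d : ℕ} (T : Finset (Pt d)) : Set (Pt d) := convexHull ℝ (T : Set (Pt d))

namespace Mesh

variable {d : ℕ} (M : Mesh d)

/-- The fictitious domain `Ω*`: the union of all cells. -/
def domain : Set (Pt d) := ⋃ T ∈ M.cells, hull T

/-- Shape regularity: `h_T ≤ κ ρ_T` for all cells, that is, each cell contains a ball of some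
radius `ρ > 0` with `diam T ≤ κ ρ`. -/
def ShapeRegular (κ : ℝ) : Prop :=
  ∀ T ∈ M.cells, ∃ (c : Pt d) (ρ : ℝ), 0 < ρ ∧ Metric.diam (hull T) ≤ κ * ρ ∧
    Metric.closedBall c ρ ⊆ hull T

open scoped Classical in
/-- The cells having `F` as a face. -/
noncomputable def patch (F : Finset (Pt d)) : Finset (Finset (Pt d)) :=
  M.cells.filter (fun T => F ⊆ T)

open scoped Classical in
/-- The interior facets: faces with `d` vertices that are shared by two cells. -/
noncomputable def interiorFacets : Finset (Finset (Pt d)) :=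
  (M.cells.biUnion (fun T => T.powersetCard d)).filter (fun F => (M.patch F).card = 2)

open scoped Classical in
/-- The cells that intersect the boundary `Γ = ∂Ω`. -/
noncomputable def cutCells (Ω : Set (Pt d)) : Finset (Finset (Pt d)) :=
  M.cells.filter (fun T => (hull T ∩ frontier Ω).Nonempty)

open scoped Classical in
/-- The interior facets that belong to at least one cell intersected by the boundary. -/
noncomputable def cutFacets (Ω : Set (Pt d)) : Finset (Finset (Pt d)) :=
  M.interiorFacets.filter (fun F => ∃ T ∈ M.patch F, T ∈ M.cutCells Ω)

open scoped Classical in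
/-- From every cut cell one reaches a non-cut cell along a sequence of at most `N` cells
`S 0, …, S m` (so `m + 1 ≤ N`) in which consecutive cells share an interior facet. -/
def BoundedWalk (Ω : Set (Pt d)) (N : ℕ) : Prop :=
  ∀ T ∈ M.cutCells Ω, ∃ T' ∈ M.cells, T' ∉ M.cutCells Ω ∧
    ∃ (m : ℕ) (S : ℕ → Finset (Pt d)), m + 1 ≤ N ∧ S 0 = T ∧ S m = T' ∧
      (∀ i ≤ m, S i ∈ M.cells) ∧ ∀ i < m, S i ∩ S (i + 1) ∈ M.interiorFacets

/-- The facet size `h_F`: the average of the diameters of the cells sharing `F`. -/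
noncomputable def facetSize (F : Finset (Pt d)) : ℝ :=
  (∑ T ∈ M.patch F, Metric.diam (hull T)) / ((M.patch F).card : ℝ)

/-- `n` assigns to every interior facet one of its two unit normals. -/
def IsUnitNormalField (n : Finset (Pt d) → Pt d) : Prop :=
  ∀ F ∈ M.interiorFacets, ‖n F‖ = 1 ∧ ∀ x ∈ F, ∀ y ∈ F, inner ℝ (n F) (x - y) = 0

/-- Continuous piecewise affine functions on the mesh. Values outside `Ω*` are irrelevant. -/
def IsP1 {W : Type*} [NormedAddCommGroup W] [NormedSpace ℝ W] (v : Pt d → W) : Prop :=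
  ContinuousOn v M.domain ∧ ∀ T ∈ M.cells, ∃ A : Pt d →ᵃ[ℝ] W, Set.EqOn v A (hull T)

/-- Discontinuous piecewise constant functions on the mesh. The values on the boundaries of cells,
which form a null set, are irrelevant. -/
def IsP0 (q : Pt d → ℝ) : Prop :=
  ∀ T ∈ M.cells, ∃ c : ℝ, ∀ x ∈ interior (hull T), q x = c

end Mesh

/-- The jump `[g](x) = g⁺(x) - g⁻(x)`, where `g^±(x)` is the limit of `g (x ± t n)` as `t → 0⁺`. -/
noncomputable def jump {d : ℕ} {W : Type*} [NormedAddCommGroup W] [NormedSpace ℝ W]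
    (n : Pt d) (g : Pt d → W) (x : Pt d) : W :=
  Filter.limUnder (𝓝[>] (0 : ℝ)) (fun t => g (x + t • n)) -
    Filter.limUnder (𝓝[>] (0 : ℝ)) (fun t => g (x - t • n))

/-- The derivative `∂ₙ v = n · ∇v` of `v` in the direction `n`. -/
noncomputable def normalDeriv {d : ℕ} {W : Type*} [NormedAddCommGroup W] [NormedSpace ℝ W]
    (n : Pt d) (v : Pt d → W) (x : Pt d) : W :=
  fderiv ℝ v x n

/-- `([g], [g])_F = ∫_F |[g]|² dS`, with the `(d-1)`-dimensional surface measure. -/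
noncomputable def facetJumpSq {d : ℕ} {W : Type*} [NormedAddCommGroup W] [NormedSpace ℝ W]
    (F : Finset (Pt d)) (n : Pt d) (g : Pt d → W) : ℝ :=
  ∫ x in hull F, ‖jump n g x‖ ^ 2 ∂μHE[d - 1]

/-- `‖∇v‖²_D`, the integral over `D` of the squared Frobenius norm of the gradient of `v`
(a piecewise affine `v` is differentiable in the interior of each cell, hence almost everywhere,
and its weak gradient is the almost everywhere gradient). -/
noncomputable def gradNormSq {d : ℕ} (v : Pt d → Pt d) (D : Set (Pt d)) : ℝ :=
  ∫ x in D, ∑ j : Fin d, ‖fderiv ℝ v x (EuclideanSpace.single j (1 : ℝ))‖ ^ 2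

/-- `‖q‖²_D`, the squared `L²(D)` norm. -/
noncomputable def normSq {d : ℕ} (q : Pt d → ℝ) (D : Set (Pt d)) : ℝ :=
  ∫ x in D, q x ^ 2

end FictitiousDomain

/-!
The gradient or the value of a discrete function on a cell is compared with that on a neighbouring
cell. Across a common facet `F` a piecewise constant function changes by its jump, and a continuous
piecewise affine function changes by the jump of its normal derivative times the signed distance to
`F`, because the two affine pieces agree on `F` (`linear_sub_eq_inner_smul`). Shape regularity makes
the diameters of neighbouring cells comparable, through a common edge, and with them the volumes of
the cells and the surface measures of the facets (`exists_sizeBounds`). For affine functions it also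
gives an inverse estimate and an extension estimate between neighbours
(`norm_sq_mul_le_setIntegral`, `setIntegral_sq_le_of_affine`), both read off from a ball on which
an affine function is large (`le_setIntegral_sq_of_affine`). So on every cell the energy is bounded
by a constant times the energy on any neighbour plus the penalty on the common facet, and the
penalty on a facet is bounded by the energies on its two cells.

The global statement is combinatorial. A cell that misses the boundary of the open set `Ω` but
meets `Ω` lies inside `Ω`, so its energy is part of the energy on `Ω`. Starting from these cells,
the cut cells are absorbed layer by layer: each layer costs a factor that depends only on the local
constant and on the dimension, since a cell has `d + 1` facets and an interior facet two cells, and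
by assumption `N` layers suffice (`Mesh.BoundedWalk.sum_cells_le`).

The penalty terms involve one-sided limits along the normal. They exist at every point of a facet
outside its proper subfaces, which are null sets for the surface measure, and there the two cells
lie on opposite sides of the facet by conformity (`facetJumpSq_eq`).
-/

namespace FictitiousDomain

/-! ### Barycentric coordinates of a cell -/

/-- `l y`, for `y ∈ T`, are the barycentric coordinate functions of the nondegenerate simplex with
vertex set `T`, extended to affine functions on the whole space. The values of `l` at points that
are not vertices are irrelevant. -/
structure IsBarycentric {d : ℕ} (T : Finset (Pt d)) (l : Pt d → (Pt d →ᵃ[ℝ] ℝ)) : Prop where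
  self : ∀ y ∈ T, l y y = 1
  ne : ∀ y ∈ T, ∀ z ∈ T, z ≠ y → l y z = 0
  sum_eq_one : ∀ x, ∑ y ∈ T, l y x = 1
  sum_smul : ∀ x, ∑ y ∈ T, l y x • y = x
  mem_hull : ∀ x, x ∈ hull T ↔ ∀ y ∈ T, 0 ≤ l y x
  mem_interior : ∀ x, x ∈ interior (hull T) ↔ ∀ y ∈ T, 0 < l y x

lemma exists_isBarycentric {d : ℕ} {T : Finset (Pt d)} (hc : T.card = d + 1)
    (hi : AffineIndependent ℝ ((↑) : T → Pt d)) : ∃ l, IsBarycentric T l := by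
  classical
  have htot : affineSpan ℝ (Set.range ((↑) : T → Pt d)) = ⊤ := by
    rw [hi.affineSpan_eq_top_iff_card_eq_finrank_add_one]
    simp [hc]
  let b : AffineBasis T ℝ (Pt d) := ⟨(↑), hi, htot⟩
  have hb : ∀ y : T, b y = (y : Pt d) := fun y => rfl
  have hr : Set.range b = (T : Set (Pt d)) := Subtype.range_coe
  let l : Pt d → (Pt d →ᵃ[ℝ] ℝ) := fun y => if h : y ∈ T then b.coord ⟨y, h⟩ else 0
  have hl : ∀ y : T, l y = b.coord y := fun y => by simp [l]
  refine ⟨l, ?_, ?_, ?_, ?_, ?_, ?_⟩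
  · intro y hy
    rw [hl ⟨y, hy⟩]
    exact b.coord_apply_eq ⟨y, hy⟩
  · intro y hy z hz hyz
    rw [hl ⟨y, hy⟩]
    exact b.coord_apply_ne (i := ⟨y, hy⟩) (j := ⟨z, hz⟩) (fun h => hyz (by simpa using h.symm))
  · intro x
    rw [← Finset.sum_coe_sort, ← b.sum_coord_apply_eq_one x]
    exact Finset.sum_congr rfl fun y _ => by rw [hl y]
  · intro x
    rw [← Finset.sum_coe_sort T (fun y => l y x • y)]
    conv_rhs => rw [← b.linear_combination_coord_eq_self x]
    exact Finset.sum_congr rfl fun y _ => by rw [hl y, hb]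
  · intro x
    rw [hull, ← hr, b.convexHull_eq_nonneg_coord]
    constructor
    · intro h y hy
      rw [hl ⟨y, hy⟩]
      exact h ⟨y, hy⟩
    · intro h y
      rw [← hl y]
      exact h y y.2
  · intro x
    rw [hull, ← hr, b.interior_convexHull]
    constructor
    · intro h y hy
      rw [hl ⟨y, hy⟩]
      exact h ⟨y, hy⟩
    · intro h y
      rw [← hl y]
      exact h y y.2

lemma hull_mono {d : ℕ} {F T : Finset (Pt d)} (h : F ⊆ T) : hull F ⊆ hull T :=
  convexHull_mono (by exact_mod_cast h)

lemma convex_hull {d : ℕ} (T : Finset (Pt d)) : Convex ℝ (hull T) := convex_convexHull ℝ _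

lemma isCompact_hull {d : ℕ} (T : Finset (Pt d)) : IsCompact (hull T) :=
  T.finite_toSet.isCompact_convexHull ℝ

lemma mem_hull_self {d : ℕ} {T : Finset (Pt d)} {x : Pt d} (h : x ∈ T) : x ∈ hull T :=
  subset_convexHull ℝ _ (by exact_mod_cast h)

lemma measurableSet_hull {d : ℕ} (T : Finset (Pt d)) : MeasurableSet (hull T) :=
  (isCompact_hull T).isClosed.measurableSet

lemma affineMap_add_smul {d : ℕ} (A : Pt d →ᵃ[ℝ] ℝ) (x w : Pt d) (t : ℝ) :
    A (x + t • w) = A x + t * A.linear w := by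
  have := A.map_vadd x (t • w)
  simp only [vadd_eq_add, map_smul, smul_eq_mul] at this
  rw [add_comm x, this, add_comm]

namespace IsBarycentric

variable {d : ℕ} {T F : Finset (Pt d)} {l : Pt d → (Pt d →ᵃ[ℝ] ℝ)}

lemma mem_hull_of_eq_zero (h : IsBarycentric T l) (hF : F ⊆ T) {x : Pt d} (hx : x ∈ hull T)
    (h0 : ∀ y ∈ T, y ∉ F → l y x = 0) : x ∈ hull F := by
  have h1 : ∑ y ∈ F, l y x = 1 := by
    rw [← h.sum_eq_one x]
    exact Finset.sum_subset hF h0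
  have h2 : ∑ y ∈ F, l y x • y = x := by
    conv_rhs => rw [← h.sum_smul x]
    exact Finset.sum_subset hF fun y hy hyF => by rw [h0 y hy hyF, zero_smul]
  rw [← h2]
  exact (convex_hull F).sum_mem (fun y hy => (h.mem_hull x).1 hx y (hF hy)) h1
    fun y hy => mem_hull_self hy

lemma eq_zero_of_mem_hull (h : IsBarycentric T l) (hF : F ⊆ T) {x y : Pt d} (hx : x ∈ hull F)
    (hy : y ∈ T) (hyF : y ∉ F) : l y x = 0 := by
  have : hull F ⊆ (l y) ⁻¹' {0} :=
    convexHull_min (fun z hz => h.ne y hy z (hF (by exact_mod_cast hz))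
      (fun e => hyF (by rw [← e]; exact_mod_cast hz)))
      ((convex_singleton (0 : ℝ)).affine_preimage (l y))
  exact this hx

/-- A point of a face that avoids all proper subfaces has positive coordinates. -/
lemma pos_of_mem_hull (h : IsBarycentric T l) (hF : F ⊆ T) {x : Pt d} (hx : x ∈ hull F)
    (hx' : ∀ y ∈ F, ∀ G ⊆ F, y ∉ G → x ∉ hull G) {y : Pt d} (hy : y ∈ F) : 0 < l y x := by
  classical
  refine lt_of_le_of_ne ((h.mem_hull x).1 (hull_mono hF hx) y (hF hy)) fun h0 => ?_
  refine hx' y hy (F.erase y) (Finset.erase_subset _ _) (Finset.notMem_erase _ _) ?_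
  refine h.mem_hull_of_eq_zero ((Finset.erase_subset _ _).trans hF) (hull_mono hF hx) ?_
  intro z hz hzF
  by_cases hzy : z = y
  · rw [hzy, ← h0]
  · exact h.eq_zero_of_mem_hull hF hx hz fun hzF' => hzF (Finset.mem_erase.2 ⟨hzy, hzF'⟩)

lemma le_one (h : IsBarycentric T l) {x y : Pt d} (hx : x ∈ hull T) (hy : y ∈ T) :
    l y x ≤ 1 := by
  rw [← h.sum_eq_one x]
  exact Finset.single_le_sum (f := fun z => l z x) (fun z hz => (h.mem_hull x).1 hx z hz) hy

/-- Moving from a point in the relative interior of the facet opposite to `a` in a direction along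
which the coordinate of `a` increases leads into the interior of the cell. -/
lemma eventually_mem_interior (h : IsBarycentric T l) {a : Pt d} {x m : Pt d}
    (hpos : ∀ y ∈ T, y ≠ a → 0 < l y x) (ha : l a x = 0) (hm : 0 < (l a).linear m) :
    ∀ᶠ t in 𝓝[>] (0 : ℝ), x + t • m ∈ interior (hull T) := by
  simp only [h.mem_interior]
  rw [Filter.eventually_all_finset]
  intro y hy
  by_cases hya : y = a
  · filter_upwards [self_mem_nhdsWithin] with t ht
    rw [hya, affineMap_add_smul, ha, zero_add]
    exact mul_pos ht hm
  · have hc : Continuous fun t : ℝ => l y x + t * (l y).linear m := by fun_prop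
    have := hc.tendsto 0
    simp only [zero_mul, add_zero] at this
    filter_upwards [nhdsWithin_le_nhds (this.eventually (lt_mem_nhds (hpos y hy hya)))] with t ht
    rw [affineMap_add_smul]
    exact ht

/-- The coordinate functions of a simplex containing a ball of radius `ρ` have slope at most
`1 / (2 ρ)`; hence any two vertices are at distance at least `2 ρ`. -/
lemma two_mul_le_dist (h : IsBarycentric T l) {c : Pt d} {ρ : ℝ} (hρ : 0 < ρ)
    (hb : Metric.closedBall c ρ ⊆ hull T) {x y : Pt d} (hx : x ∈ T) (hy : y ∈ T) (hxy : x ≠ y) :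
    2 * ρ ≤ dist x y := by
  have hD : 0 < dist x y := dist_pos.2 hxy
  have hn : ‖x - y‖ = dist x y := (dist_eq_norm x y).symm
  have key : ∀ s : ℝ, |s| = ρ / dist x y → c + s • (x - y) ∈ hull T := by
    intro s hs
    apply hb
    rw [Metric.mem_closedBall, dist_eq_norm, add_sub_cancel_left, norm_smul, Real.norm_eq_abs, hs,
      hn, div_mul_cancel₀ _ hD.ne']
  have e1 : (l x).linear (x - y) = 1 := by
    have := (l x).linearMap_vsub x y
    simp only [vsub_eq_sub] at this
    rw [this, h.self x hx, h.ne x hx y hy hxy.symm, sub_zero]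
  have hs0 : 0 < ρ / dist x y := by positivity
  have h1 := h.le_one (key (ρ / dist x y) (abs_of_pos hs0)) hx
  have h2 := (h.mem_hull _).1 (key (-(ρ / dist x y)) (by rw [abs_neg, abs_of_pos hs0])) x hx
  rw [affineMap_add_smul, e1] at h1 h2
  have h3 : 2 * (ρ / dist x y) ≤ 1 := by linarith
  rw [← mul_div_assoc, div_le_one hD] at h3
  exact h3

end IsBarycentric

/-! ### Facets and their normals -/

section Facet

variable {d : ℕ} {T F : Finset (Pt d)}

lemma vectorSpan_facet_eq (hd : 1 ≤ d) (hc : F.card = d)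
    (hi : AffineIndependent ℝ ((↑) : F → Pt d)) {n : Pt d} (hn : ‖n‖ = 1)
    (hF : ∀ x ∈ F, ∀ y ∈ F, inner ℝ n (x - y) = 0) :
    vectorSpan ℝ (F : Set (Pt d)) = (ℝ ∙ n)ᗮ := by
  have hn0 : n ≠ 0 := by
    rintro rfl
    simp at hn
  apply Submodule.eq_of_le_of_finrank_eq
  · rw [vectorSpan_def, Submodule.span_le]
    rintro _ ⟨x, hx, y, hy, rfl⟩
    exact Submodule.mem_orthogonal_singleton_iff_inner_right.2
      (hF x (by exact_mod_cast hx) y (by exact_mod_cast hy))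
  · have h1 : Module.finrank ℝ (vectorSpan ℝ (Set.range ((↑) : F → Pt d))) = d - 1 :=
      hi.finrank_vectorSpan (by rw [Fintype.card_coe]; omega)
    have h2 : Module.finrank ℝ (ℝ ∙ n)ᗮ = d - 1 := by
      have := Submodule.finrank_add_finrank_orthogonal (ℝ ∙ n)
      rw [finrank_span_singleton hn0] at this
      simp only [finrank_euclideanSpace, Fintype.card_fin] at this
      omega
    have h3 : Set.range ((↑) : F → Pt d) = (F : Set (Pt d)) := Subtype.range_coe
    rw [← h3, h1, h2]

/-- A linear map that vanishes along a facet is determined by its value on the unit normal. -/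
lemma linear_eq_inner_smul {W : Type*} [AddCommGroup W] [Module ℝ W] (hd : 1 ≤ d)
    (hc : F.card = d) (hi : AffineIndependent ℝ ((↑) : F → Pt d)) {n : Pt d} (hn : ‖n‖ = 1)
    (hF : ∀ x ∈ F, ∀ y ∈ F, inner ℝ n (x - y) = 0) (D : Pt d →ₗ[ℝ] W)
    (hD : ∀ x ∈ F, ∀ y ∈ F, D (x - y) = 0) (w : Pt d) : D w = (inner ℝ n w : ℝ) • D n := by
  have hle : (ℝ ∙ n)ᗮ ≤ LinearMap.ker D := by
    rw [← vectorSpan_facet_eq hd hc hi hn hF, vectorSpan_def, Submodule.span_le]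
    rintro _ ⟨x, hx, y, hy, rfl⟩
    exact hD x (by exact_mod_cast hx) y (by exact_mod_cast hy)
  have hm : w - (inner ℝ n w : ℝ) • n ∈ (ℝ ∙ n)ᗮ := by
    rw [Submodule.mem_orthogonal_singleton_iff_inner_right, inner_sub_right, inner_smul_right,
      real_inner_self_eq_norm_sq, hn]
    ring
  have := hle hm
  rw [LinearMap.mem_ker, map_sub, map_smul, sub_eq_zero] at this
  exact this

lemma exists_opposite_vertex (hc : T.card = d + 1) (hF : F ⊆ T) (hFc : F.card = d) :
    ∃ a ∈ T, a ∉ F ∧ ∀ y ∈ T, y ≠ a → y ∈ F := by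
  classical
  have h1 : (T \ F).card = 1 := by rw [Finset.card_sdiff_of_subset hF]; omega
  obtain ⟨a, ha⟩ := Finset.card_eq_one.1 h1
  have ha' : a ∈ T \ F := by rw [ha]; exact Finset.mem_singleton_self a
  refine ⟨a, (Finset.mem_sdiff.1 ha').1, (Finset.mem_sdiff.1 ha').2, fun y hy hya => ?_⟩
  by_contra hyF
  have : y ∈ T \ F := Finset.mem_sdiff.2 ⟨hy, hyF⟩
  rw [ha] at this
  exact hya (Finset.mem_singleton.1 this)

end Facet

/-! ### Surface measure of facets -/

/-- The volume of the unit ball of `ℝᵏ`. -/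
noncomputable def unitBallVol (k : ℕ) : ℝ :=
  (volume : Measure (EuclideanSpace ℝ (Fin k))).real (Metric.ball 0 1)

lemma unitBallVol_pos (k : ℕ) : 0 < unitBallVol k :=
  ENNReal.toReal_pos (Metric.measure_ball_pos _ _ one_pos).ne' measure_ball_lt_top.ne

lemma volume_real_closedBall {k : ℕ} (x : EuclideanSpace ℝ (Fin k)) {r : ℝ} (hr : 0 ≤ r) :
    (volume : Measure (EuclideanSpace ℝ (Fin k))).real (Metric.closedBall x r) =
      unitBallVol k * r ^ k := by
  rw [Measure.addHaar_real_closedBall _ _ hr, unitBallVol, finrank_euclideanSpace,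
    Fintype.card_fin, mul_comm]

/-- The ball of radius `r` around `p` inside the hyperplane through `p` with normal `n`. -/
def hyperplaneBall {d : ℕ} (n p : Pt d) (r : ℝ) : Set (Pt d) :=
  {x | inner ℝ n (x - p) = 0 ∧ ‖x - p‖ ≤ r}

lemma euclideanHausdorffMeasure_hyperplaneBall {d : ℕ} {n : Pt d} (hn : ‖n‖ = 1) (p : Pt d)
    (r : ℝ) : μHE[d - 1] (hyperplaneBall n p r) =
      volume (Metric.closedBall (0 : EuclideanSpace ℝ (Fin (d - 1))) r) := by
  have hn0 : n ≠ 0 := by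
    rintro rfl
    simp at hn
  have hr : Module.finrank ℝ (ℝ ∙ n)ᗮ = d - 1 := by
    have := Submodule.finrank_add_finrank_orthogonal (ℝ ∙ n)
    rw [finrank_span_singleton hn0] at this
    simp only [finrank_euclideanSpace, Fintype.card_fin] at this
    omega
  let e : (ℝ ∙ n)ᗮ ≃ₗᵢ[ℝ] EuclideanSpace ℝ (Fin (d - 1)) :=
    ((stdOrthonormalBasis ℝ (ℝ ∙ n)ᗮ).reindex (finCongr hr)).repr
  let f : EuclideanSpace ℝ (Fin (d - 1)) → Pt d := fun y => p + ((e.symm y : (ℝ ∙ n)ᗮ) : Pt d)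
  have hf : Isometry f :=
    (IsometryEquiv.addLeft p).isometry.comp ((ℝ ∙ n)ᗮ.subtypeₗᵢ.isometry.comp e.symm.isometry)
  rw [← EuclideanSpace.euclideanHausdorffMeasure_eq_volume, ← hf.euclideanHausdorffMeasure_image]
  congr 1
  ext x
  simp only [hyperplaneBall, Set.mem_ofPred_eq, Set.mem_image, mem_closedBall_zero_iff]
  constructor
  · rintro ⟨h1, h2⟩
    refine ⟨e ⟨x - p, Submodule.mem_orthogonal_singleton_iff_inner_right.2 h1⟩, ?_, ?_⟩
    · rw [e.norm_map]
      exact h2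
    · simp [f]
  · rintro ⟨y, hy, rfl⟩
    have h1 := (e.symm y).2
    rw [Submodule.mem_orthogonal_singleton_iff_inner_right] at h1
    refine ⟨by simpa [f] using h1, ?_⟩
    simp only [f, add_sub_cancel_left]
    exact (e.symm.norm_map y).trans_le hy

lemma measureReal_hyperplaneBall {d : ℕ} {n : Pt d} (hn : ‖n‖ = 1) (p : Pt d)
    {r : ℝ} (hr : 0 ≤ r) : (μHE[d - 1] : Measure (Pt d)).real (hyperplaneBall n p r) =
      unitBallVol (d - 1) * r ^ (d - 1) := by
  rw [← volume_real_closedBall 0 hr, measureReal_def, measureReal_def,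
    euclideanHausdorffMeasure_hyperplaneBall hn]

lemma measure_hyperplaneBall_ne_top {d : ℕ} {n : Pt d} (hn : ‖n‖ = 1) (p : Pt d) (r : ℝ) :
    μHE[d - 1] (hyperplaneBall n p r) ≠ ⊤ := by
  rw [euclideanHausdorffMeasure_hyperplaneBall hn]
  exact measure_closedBall_lt_top.ne

section

variable {d : ℕ} {T F : Finset (Pt d)} {n : Pt d}

lemma inner_sub_eq_zero_of_mem_hull (hF : ∀ x ∈ F, ∀ y ∈ F, inner ℝ n (x - y) = 0)
    {x p : Pt d} (hp : p ∈ F) (hx : x ∈ hull F) : inner ℝ n (x - p) = 0 := by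
  have h : hull F ⊆ {x | inner ℝ n x = inner ℝ n p} :=
    convexHull_min (fun y hy => by
      have := hF y (by exact_mod_cast hy) p hp
      rwa [inner_sub_right, sub_eq_zero] at this)
      (convex_hyperplane (innerSL ℝ n).isLinear _)
  rw [inner_sub_right, sub_eq_zero]
  exact h hx

lemma hull_subset_hyperplaneBall (hFT : F ⊆ T)
    (hF : ∀ x ∈ F, ∀ y ∈ F, inner ℝ n (x - y) = 0) {p : Pt d} (hp : p ∈ F) :
    hull F ⊆ hyperplaneBall n p (Metric.diam (hull T)) := fun x hx =>
  ⟨inner_sub_eq_zero_of_mem_hull hF hp hx, by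
    rw [← dist_eq_norm]
    exact Metric.dist_le_diam_of_mem (isCompact_hull T).isBounded (hull_mono hFT hx)
      (mem_hull_self (hFT hp))⟩

lemma measure_hull_facet_ne_top (hn : ‖n‖ = 1)
    (hF : ∀ x ∈ F, ∀ y ∈ F, inner ℝ n (x - y) = 0) {p : Pt d} (hp : p ∈ F) :
    μHE[d - 1] (hull F) ≠ ⊤ :=
  ne_top_of_le_ne_top (measure_hyperplaneBall_ne_top hn _ _)
    (measure_mono (hull_subset_hyperplaneBall subset_rfl hF hp))

lemma measureReal_hull_facet_le (hn : ‖n‖ = 1) (hFT : F ⊆ T)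
    (hF : ∀ x ∈ F, ∀ y ∈ F, inner ℝ n (x - y) = 0) {p : Pt d} (hp : p ∈ F) :
    (μHE[d - 1] : Measure (Pt d)).real (hull F) ≤
      unitBallVol (d - 1) * Metric.diam (hull T) ^ (d - 1) := by
  rw [← measureReal_hyperplaneBall hn p Metric.diam_nonneg]
  exact measureReal_mono (hull_subset_hyperplaneBall hFT hF hp)
    (measure_hyperplaneBall_ne_top hn _ _)

/-- A facet of a simplex containing a ball of radius `ρ` contains a ball of radius `ρ` in its
hyperplane: the section of the simplex through the centre of the ball and parallel to the facet is
mapped onto the facet by a homothety centred at the opposite vertex. -/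
lemma exists_hyperplaneBall_subset (hd : 1 ≤ d) (hc : T.card = d + 1)
    (hi : AffineIndependent ℝ ((↑) : T → Pt d)) (hFT : F ⊆ T) (hFc : F.card = d)
    (hn : ‖n‖ = 1) (hF : ∀ x ∈ F, ∀ y ∈ F, inner ℝ n (x - y) = 0) {c : Pt d} {ρ : ℝ}
    (hρ : 0 < ρ) (hb : Metric.closedBall c ρ ⊆ hull T) :
    ∃ p, hyperplaneBall n p ρ ⊆ hull F := by
  obtain ⟨l, hl⟩ := exists_isBarycentric hc hi
  obtain ⟨a, haT, haF, ha⟩ := exists_opposite_vertex hc hFT hFc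
  have hFi : AffineIndependent ℝ ((↑) : F → Pt d) := hi.mono (by exact_mod_cast hFT)
  have hcint : c ∈ interior (hull T) :=
    mem_interior.2 ⟨Metric.ball c ρ, Metric.ball_subset_closedBall.trans hb, Metric.isOpen_ball,
      Metric.mem_ball_self hρ⟩
  have hpos := (hl.mem_interior c).1 hcint
  have hF0 : 0 < F.card := by omega
  obtain ⟨b, hbF⟩ := Finset.card_pos.1 hF0
  have hab : a ≠ b := fun h => haF (h ▸ hbF)
  set s := l a c with hs
  have hs0 : 0 < s := hpos a haT
  have hs1 : s < 1 := by
    have h1 : l a c + l b c ≤ 1 := by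
      classical
      rw [← hl.sum_eq_one c, ← Finset.sum_pair (f := fun y => l y c) hab]
      refine Finset.sum_le_sum_of_subset_of_nonneg ?_ fun y hy _ => (hpos y hy).le
      intro y hy
      rcases Finset.mem_insert.1 hy with rfl | hy
      · exact haT
      · rw [Finset.mem_singleton.1 hy]
        exact hFT hbF
    have := hpos b (hFT hbF)
    linarith
  have h1s : 0 < 1 - s := by linarith
  refine ⟨a + (1 - s)⁻¹ • (c - a), fun x hx => ?_⟩
  obtain ⟨hx1, hx2⟩ := hx
  -- The homothety with centre `a` and ratio `(1 - s)⁻¹` takes the section `l a = s` to `l a = 0`.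
  -- `z` is the point of the parallel section through `c` that corresponds to `x`.
  set z := c + (1 - s) • (x - (a + (1 - s)⁻¹ • (c - a))) with hz
  have hzT : z ∈ hull T := by
    apply hb
    rw [Metric.mem_closedBall, dist_eq_norm, hz, add_sub_cancel_left, norm_smul,
      Real.norm_of_nonneg h1s.le]
    calc (1 - s) * _ ≤ 1 * ρ := by gcongr; linarith
      _ = ρ := one_mul ρ
  have hxz : x = a + (1 - s)⁻¹ • (z - a) := by
    have : z - a = (c - a) + (1 - s) • (x - (a + (1 - s)⁻¹ • (c - a))) := by rw [hz]; abel
    rw [this, smul_add, smul_smul, inv_mul_cancel₀ h1s.ne', one_smul]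
    abel
  have hlx : ∀ y, l y x = l y a + (1 - s)⁻¹ * (l y z - l y a) := by
    intro y
    rw [hxz, affineMap_add_smul]
    congr 2
    exact (l y).linearMap_vsub z a
  have hla : l a z = s := by
    rw [hz, affineMap_add_smul, linear_eq_inner_smul hd hFc hFi hn hF (l a).linear, hx1,
      zero_smul, mul_zero, add_zero]
    intro y hy w hw
    have := (l a).linearMap_vsub y w
    simp only [vsub_eq_sub] at this
    rw [this, hl.ne a haT y (hFT hy) (fun h => haF (h ▸ hy)),
      hl.ne a haT w (hFT hw) (fun h => haF (h ▸ hw)), sub_zero]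
  have hxa : l a x = 0 := by
    rw [hlx, hla, hl.self a haT]
    field_simp
    ring
  refine hl.mem_hull_of_eq_zero hFT ((hl.mem_hull x).2 fun y hy => ?_) fun y hy hyF => ?_
  · by_cases hya : y = a
    · rw [hya, hxa]
    · rw [hlx, hl.ne y hy a haT (Ne.symm hya), zero_add, sub_zero]
      exact mul_nonneg (inv_nonneg.2 h1s.le) ((hl.mem_hull z).1 hzT y hy)
  · have : y = a := by
      by_contra h
      exact hyF (ha y hy h)
    rw [this, hxa]

lemma le_measureReal_hull_facet (hd : 1 ≤ d) (hc : T.card = d + 1)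
    (hi : AffineIndependent ℝ ((↑) : T → Pt d)) (hFT : F ⊆ T) (hFc : F.card = d)
    (hn : ‖n‖ = 1) (hF : ∀ x ∈ F, ∀ y ∈ F, inner ℝ n (x - y) = 0) {c : Pt d} {ρ : ℝ}
    (hρ : 0 < ρ) (hb : Metric.closedBall c ρ ⊆ hull T) :
    unitBallVol (d - 1) * ρ ^ (d - 1) ≤ (μHE[d - 1] : Measure (Pt d)).real (hull F) := by
  obtain ⟨p, hp⟩ := exists_hyperplaneBall_subset hd hc hi hFT hFc hn hF hρ hb
  have hF0 : 0 < F.card := by omega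
  obtain ⟨b, hbF⟩ := Finset.card_pos.1 hF0
  rw [← measureReal_hyperplaneBall hn p hρ.le]
  exact measureReal_mono hp (measure_hull_facet_ne_top hn hF hbF)

end

lemma dimH_hull_le {d k : ℕ} {G : Finset (Pt d)} (hG : G.card ≤ k + 1) : dimH (hull G) ≤ k := by
  rcases G.eq_empty_or_nonempty with rfl | ⟨p, hp⟩
  · simp [hull]
  have hr : Module.finrank ℝ (vectorSpan ℝ (G : Set (Pt d))) ≤ k := by
    obtain ⟨m, hm⟩ : ∃ m, G.card = m + 1 := ⟨G.card - 1, by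
      have := Finset.card_pos.2 ⟨p, hp⟩
      omega⟩
    have h := finrank_vectorSpan_range_le ℝ ((↑) : G → Pt d) (n := m) (by simpa using hm)
    have h3 : Set.range ((↑) : G → Pt d) = (G : Set (Pt d)) := Subtype.range_coe
    rw [h3] at h
    omega
  let f : vectorSpan ℝ (G : Set (Pt d)) → Pt d := fun w => p + w
  have hf : Isometry f :=
    (IsometryEquiv.addLeft p).isometry.comp (vectorSpan ℝ (G : Set (Pt d))).subtypeₗᵢ.isometry
  have hsub : hull G ⊆ f '' Set.univ := by
    intro x hx
    have hx' : x ∈ affineSpan ℝ (G : Set (Pt d)) := convexHull_subset_affineSpan _ hx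
    refine ⟨⟨x - p, ?_⟩, trivial, by simp [f]⟩
    rw [← direction_affineSpan]
    exact AffineSubspace.vsub_mem_direction hx' (subset_affineSpan ℝ _ (by exact_mod_cast hp))
  calc dimH (hull G) ≤ dimH (f '' Set.univ) := dimH_mono hsub
    _ = Module.finrank ℝ (vectorSpan ℝ (G : Set (Pt d))) := by
      rw [hf.dimH_image, Real.dimH_univ_eq_finrank]
    _ ≤ k := by exact_mod_cast hr

lemma euclideanHausdorffMeasure_hull_eq_zero {d k : ℕ} {G : Finset (Pt d)} (hG : G.card ≤ k) :
    μHE[k] (hull G) = 0 := by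
  rcases Nat.eq_zero_or_pos k with rfl | hk
  · rw [Finset.card_eq_zero.1 (Nat.le_zero.1 hG)]
    simp [hull]
  · have h : dimH (hull G) < ((k : NNReal) : ENNReal) := by
      refine (dimH_hull_le (k := k - 1) (by omega)).trans_lt ?_
      rw [ENNReal.coe_natCast]
      exact_mod_cast (by omega : k - 1 < k)
    have := hausdorffMeasure_of_dimH_lt h
    rw [Measure.euclideanHausdorffMeasure_def, Measure.smul_apply]
    rw [NNReal.coe_natCast] at this
    rw [this, smul_zero]

lemma volume_hull_eq_zero {d : ℕ} {G : Finset (Pt d)} (hG : G.card ≤ d) :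
    volume (hull G) = 0 := by
  rw [← EuclideanSpace.euclideanHausdorffMeasure_eq_volume]
  exact euclideanHausdorffMeasure_hull_eq_zero hG

lemma volume_frontier_hull {d : ℕ} (T : Finset (Pt d)) : volume (frontier (hull T)) = 0 :=
  (convex_hull T).addHaar_frontier volume

/-! ### Jumps across interior facets -/

namespace Mesh

variable {d : ℕ} {M : Mesh d}

lemma mem_patch {F T : Finset (Pt d)} : T ∈ M.patch F ↔ T ∈ M.cells ∧ F ⊆ T := by
  simp [patch]

lemma mem_interiorFacets {F : Finset (Pt d)} :
    F ∈ M.interiorFacets ↔ (∃ T ∈ M.cells, F ⊆ T ∧ F.card = d) ∧ (M.patch F).card = 2 := by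
  simp [interiorFacets]

lemma card_of_mem_interiorFacets {F : Finset (Pt d)} (hF : F ∈ M.interiorFacets) :
    F.card = d := by
  obtain ⟨⟨_, _, _, h⟩, _⟩ := mem_interiorFacets.1 hF
  exact h

lemma isBarycentric (M : Mesh d) {T : Finset (Pt d)} (hT : T ∈ M.cells) :
    ∃ l, IsBarycentric T l :=
  exists_isBarycentric (M.card_eq T hT) (M.indep T hT)

/-- The two distinct cells that share an interior facet. -/
lemma exists_patch_eq {F : Finset (Pt d)} (hF : F ∈ M.interiorFacets) :
    ∃ S T, S ≠ T ∧ S ∈ M.cells ∧ T ∈ M.cells ∧ F ⊆ S ∧ F ⊆ T ∧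
      ∀ f : Finset (Pt d) → ℝ, ∑ R ∈ M.patch F, f R = f S + f T := by
  classical
  obtain ⟨S, T, hST, h⟩ := Finset.card_eq_two.1 (mem_interiorFacets.1 hF).2
  have hS : S ∈ M.patch F := by rw [h]; simp
  have hT : T ∈ M.patch F := by rw [h]; simp
  refine ⟨S, T, hST, (mem_patch.1 hS).1, (mem_patch.1 hT).1, (mem_patch.1 hS).2,
    (mem_patch.1 hT).2, fun f => ?_⟩
  rw [h, Finset.sum_pair hST]

/-- Distinct cells sharing a facet meet only in that facet. -/
lemma inter_subset_hull {S T F : Finset (Pt d)} (hS : S ∈ M.cells) (hT : T ∈ M.cells)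
    (hST : S ≠ T) (hFS : F ⊆ S) (hFT : F ⊆ T) (hFc : F.card = d) :
    hull S ∩ hull T ⊆ hull F := by
  classical
  have h1 : F = S ∩ T := by
    refine Finset.eq_of_subset_of_card_le (Finset.subset_inter hFS hFT) ?_
    by_contra! h
    have h2 : S ∩ T = S := Finset.eq_of_subset_of_card_le Finset.inter_subset_left (by
      rw [M.card_eq S hS]; omega)
    have h3 : S ∩ T = T := Finset.eq_of_subset_of_card_le Finset.inter_subset_right (by
      rw [M.card_eq T hT]; omega)
    exact hST (h2.symm.trans h3)
  refine (M.conforming S hS T hT).trans ?_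
  rw [h1, hull, Finset.coe_inter]

end Mesh

/-- The points of a face that lie on none of its proper subfaces. -/
def relInt {d : ℕ} (F : Finset (Pt d)) : Set (Pt d) :=
  {x | x ∈ hull F ∧ ∀ y ∈ F, ∀ G ⊆ F, y ∉ G → x ∉ hull G}

/-- The proper subfaces of a facet have dimension at most `d - 2`, hence no surface measure. -/
lemma ae_mem_relInt {d : ℕ} (hd : 1 ≤ d) {F : Finset (Pt d)} (hFc : F.card = d) :
    ∀ᵐ x ∂(μHE[d - 1] : Measure (Pt d)).restrict (hull F), x ∈ relInt F := by
  have h : ∀ᵐ x ∂(μHE[d - 1] : Measure (Pt d)).restrict (hull F),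
      ∀ G ∈ F.powerset.filter (fun G => G.card ≤ d - 1), x ∉ hull G := by
    rw [Finset.eventually_all]
    intro G hG
    refine ae_restrict_of_ae ?_
    rw [ae_iff]
    simpa using euclideanHausdorffMeasure_hull_eq_zero (Finset.mem_filter.1 hG).2
  filter_upwards [h, ae_restrict_mem (measurableSet_hull F)] with x hx hxF
  refine ⟨hxF, fun y hy G hG hyG => hx G ?_⟩
  rw [Finset.mem_filter, Finset.mem_powerset]
  refine ⟨hG, ?_⟩
  have : G.card < F.card := Finset.card_lt_card ⟨hG, fun h => hyG (h hy)⟩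
  omega

section

variable {d : ℕ} {T F : Finset (Pt d)}

/-- A cell lies on one side of each of its facets: `s = ± 1` is the sign of the normal direction
that leads from the relative interior of the facet into the interior of the cell. -/
lemma exists_side (hd : 1 ≤ d) (hc : T.card = d + 1)
    (hi : AffineIndependent ℝ ((↑) : T → Pt d)) (hFT : F ⊆ T) (hFc : F.card = d)
    {n : Pt d} (hn : ‖n‖ = 1) (hF : ∀ x ∈ F, ∀ y ∈ F, inner ℝ n (x - y) = 0) :
    ∃ s : ℝ, (s = 1 ∨ s = -1) ∧ ∀ x ∈ relInt F,
      ∀ᶠ t in 𝓝[>] (0 : ℝ), x + t • (s • n) ∈ interior (hull T) \ hull F := by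
  obtain ⟨l, hl⟩ := exists_isBarycentric hc hi
  obtain ⟨a, haT, haF, ha⟩ := exists_opposite_vertex hc hFT hFc
  have hFi : AffineIndependent ℝ ((↑) : F → Pt d) := hi.mono (by exact_mod_cast hFT)
  obtain ⟨b, hbF⟩ := Finset.card_pos.1 (by omega : 0 < F.card)
  have hlin : ∀ x y, (l a).linear (x - y) = l a x - l a y := fun x y => (l a).linearMap_vsub x y
  have h1 : (l a).linear n ≠ 0 := by
    intro h0
    have h2 := linear_eq_inner_smul hd hFc hFi hn hF (l a).linear (fun x hx y hy => by
      rw [hlin, hl.ne a haT x (hFT hx) (fun h => haF (h ▸ hx)),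
        hl.ne a haT y (hFT hy) (fun h => haF (h ▸ hy)), sub_zero]) (a - b)
    rw [hlin, h0, smul_zero, hl.self a haT, hl.ne a haT b (hFT hbF) (fun h => haF (h ▸ hbF))] at h2
    norm_num at h2
  obtain ⟨s, hs, hs'⟩ : ∃ s : ℝ, (s = 1 ∨ s = -1) ∧ 0 < (l a).linear (s • n) := by
    rcases lt_or_gt_of_ne h1 with h | h
    · exact ⟨-1, Or.inr rfl, by rw [map_smul, smul_eq_mul]; linarith⟩
    · exact ⟨1, Or.inl rfl, by rw [map_smul, smul_eq_mul]; linarith⟩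
  refine ⟨s, hs, fun x hx => ?_⟩
  have hev := hl.eventually_mem_interior (a := a) (x := x) (m := s • n)
    (fun y hy hya => hl.pos_of_mem_hull hFT hx.1 hx.2 (ha y hy hya))
    (hl.eq_zero_of_mem_hull hFT hx.1 haT haF) hs'
  filter_upwards [hev] with t ht
  refine ⟨ht, fun htF => ?_⟩
  have := (hl.mem_interior _).1 ht a haT
  rw [hl.eq_zero_of_mem_hull hFT htF haT haF] at this
  exact lt_irrefl _ this

end

lemma limUnder_of_eventually_eq {W : Type*} [TopologicalSpace W] [T2Space W] [Nonempty W]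
    {g : ℝ → W} {c : W} (h : ∀ᶠ t in 𝓝[>] (0 : ℝ), g t = c) :
    Filter.limUnder (𝓝[>] (0 : ℝ)) g = c :=
  (tendsto_const_nhds.congr' (h.mono fun _ ht => ht.symm)).limUnder_eq

/-- The two cells sharing a facet lie on opposite sides of it, so the jump of a function that is
constant in the interior of each of them is, up to sign, the difference of the two constants. -/
lemma norm_jump_eq {d : ℕ} {M : Mesh d} {W : Type*} [NormedAddCommGroup W] [NormedSpace ℝ W]
    (hd : 1 ≤ d) {S T F : Finset (Pt d)} (hS : S ∈ M.cells) (hT : T ∈ M.cells)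
    (hST : S ≠ T) (hFS : F ⊆ S) (hFT : F ⊆ T) (hFc : F.card = d)
    {n : Pt d} (hn : ‖n‖ = 1) (hF : ∀ x ∈ F, ∀ y ∈ F, inner ℝ n (x - y) = 0)
    {g : Pt d → W} {c c' : W} (hc : ∀ x ∈ interior (hull S), g x = c)
    (hc' : ∀ x ∈ interior (hull T), g x = c') {x : Pt d} (hx : x ∈ relInt F) :
    ‖jump n g x‖ = ‖c - c'‖ := by
  obtain ⟨s, hs, hsx⟩ := exists_side hd (M.card_eq S hS) (M.indep S hS) hFS hFc hn hF
  obtain ⟨s', hs', hsx'⟩ := exists_side hd (M.card_eq T hT) (M.indep T hT) hFT hFc hn hF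
  -- If both cells were on the same side, nearby points off the facet would be in both of them.
  have hss : s ≠ s' := by
    rintro rfl
    obtain ⟨t, ht, ht'⟩ := ((hsx x hx).and (hsx' x hx)).exists
    exact ht.2 (Mesh.inter_subset_hull hS hT hST hFS hFT hFc
      ⟨interior_subset ht.1, interior_subset ht'.1⟩)
  have h1 := hsx x hx
  have h2 := hsx' x hx
  have hneg : ∀ t : ℝ, x + t • ((-1 : ℝ) • n) = x - t • n := fun t => by
    rw [neg_one_smul, smul_neg, sub_eq_add_neg]
  have hone : ∀ t : ℝ, x + t • ((1 : ℝ) • n) = x + t • n := fun t => by rw [one_smul]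
  rcases hs with rfl | rfl <;> rcases hs' with rfl | rfl
  · exact absurd rfl hss
  · simp only [hneg, hone] at h1 h2
    rw [jump, limUnder_of_eventually_eq (h1.mono fun t ht => hc _ ht.1),
      limUnder_of_eventually_eq (h2.mono fun t ht => hc' _ ht.1)]
  · simp only [hneg, hone] at h1 h2
    rw [jump, limUnder_of_eventually_eq (h1.mono fun t ht => hc _ ht.1),
      limUnder_of_eventually_eq (h2.mono fun t ht => hc' _ ht.1), norm_sub_rev]
  · exact absurd rfl hss

lemma facetJumpSq_eq {d : ℕ} {M : Mesh d} {W : Type*} [NormedAddCommGroup W] [NormedSpace ℝ W]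
    (hd : 1 ≤ d) {S T F : Finset (Pt d)} (hS : S ∈ M.cells) (hT : T ∈ M.cells)
    (hST : S ≠ T) (hFS : F ⊆ S) (hFT : F ⊆ T) (hFc : F.card = d)
    {n : Pt d} (hn : ‖n‖ = 1) (hF : ∀ x ∈ F, ∀ y ∈ F, inner ℝ n (x - y) = 0)
    {g : Pt d → W} {c c' : W} (hc : ∀ x ∈ interior (hull S), g x = c)
    (hc' : ∀ x ∈ interior (hull T), g x = c') :
    facetJumpSq F n g = ‖c - c'‖ ^ 2 * (μHE[d - 1] : Measure (Pt d)).real (hull F) := by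
  have h : ∀ᵐ x ∂(μHE[d - 1] : Measure (Pt d)).restrict (hull F),
      ‖jump n g x‖ ^ 2 = ‖c - c'‖ ^ 2 := by
    filter_upwards [ae_mem_relInt hd hFc] with x hx
    rw [norm_jump_eq hd hS hT hST hFS hFT hFc hn hF hc hc' hx]
  rw [facetJumpSq, integral_congr_ae h, setIntegral_const, smul_eq_mul, mul_comm]

/-! ### Integrals over the mesh -/

namespace Mesh

variable {d : ℕ} {M : Mesh d}

lemma mem_cutCells {Ω : Set (Pt d)} {T : Finset (Pt d)} :
    T ∈ M.cutCells Ω ↔ T ∈ M.cells ∧ (hull T ∩ frontier Ω).Nonempty := by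
  simp [cutCells]

lemma aedisjoint_hull {S T : Finset (Pt d)} (hS : S ∈ M.cells) (hT : T ∈ M.cells)
    (hST : S ≠ T) : AEDisjoint volume (hull S) (hull T) := by
  classical
  have h : hull S ∩ hull T ⊆ hull (S ∩ T) := by
    rw [hull, hull, hull, Finset.coe_inter]
    exact M.conforming S hS T hT
  refine measure_mono_null h (volume_hull_eq_zero ?_)
  by_contra! h2
  have h3 : S ∩ T = S := Finset.eq_of_subset_of_card_le Finset.inter_subset_left (by
    rw [M.card_eq S hS]; omega)
  have h4 : S ∩ T = T := Finset.eq_of_subset_of_card_le Finset.inter_subset_right (by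
    rw [M.card_eq T hT]; omega)
  exact hST (h3.symm.trans h4)

lemma setIntegral_biUnion_cells {s : Finset (Finset (Pt d))} (hs : s ⊆ M.cells) {f : Pt d → ℝ}
    (hf : ∀ T ∈ M.cells, IntegrableOn f (hull T)) :
    ∫ x in ⋃ T ∈ s, hull T, f x = ∑ T ∈ s, ∫ x in hull T, f x := by
  have h1 : (⋃ T ∈ s, hull T) = ⋃ T : s, hull (T : Finset (Pt d)) := by
    ext x; simp
  rw [h1, integral_iUnion_ae (fun T => (measurableSet_hull _).nullMeasurableSet)
    (fun S T hST => aedisjoint_hull (hs S.2) (hs T.2) (fun h => hST (Subtype.ext h)))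
    (h1 ▸ integrableOn_finset_iUnion.2 fun T hT => hf T (hs hT)), tsum_fintype]
  exact Finset.sum_coe_sort s fun T => ∫ x in hull T, f x

lemma integrableOn_domain {f : Pt d → ℝ} (hf : ∀ T ∈ M.cells, IntegrableOn f (hull T)) :
    IntegrableOn f M.domain := by
  rw [domain, integrableOn_finset_iUnion]
  exact hf

/-- A cell that does not meet the boundary of the physical domain is contained in it. -/
lemma hull_subset_of_notMem_cutCells {Ω : Set (Pt d)} (hΩ : IsOpen Ω)
    (hne : ∀ T ∈ M.cells, (hull T ∩ Ω).Nonempty) {T : Finset (Pt d)} (hT : T ∈ M.cells)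
    (hcut : T ∉ M.cutCells Ω) : hull T ⊆ Ω := by
  have h0 : hull T ∩ frontier Ω = ∅ := by
    by_contra h
    exact hcut (mem_cutCells.2 ⟨hT, Set.nonempty_iff_ne_empty.2 h⟩)
  have h1 : IsPreconnected (hull T) := (convex_hull T).isPreconnected
  refine h1.subset_left_of_subset_union hΩ isClosed_closure.isOpen_compl
    (Set.disjoint_left.2 fun x hx hx' => hx' (subset_closure hx)) (fun x hx => ?_) (hne T hT)
  by_contra h
  rw [Set.mem_union, not_or] at h
  have hx' : x ∈ hull T ∩ frontier Ω :=
    ⟨hx, by rw [hΩ.frontier_eq]; exact ⟨not_not.1 h.2, h.1⟩⟩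
  rw [h0] at hx'
  exact hx'

end Mesh

/-! ### Consequences of shape regularity -/

/-- The volume of a cell. -/
noncomputable def cellVol {d : ℕ} (T : Finset (Pt d)) : ℝ :=
  (volume : Measure (Pt d)).real (hull T)

/-- The `(d-1)`-dimensional measure of a facet. -/
noncomputable def facetArea {d : ℕ} (F : Finset (Pt d)) : ℝ :=
  (μHE[d - 1] : Measure (Pt d)).real (hull F)

/-- `T` contains the ball of radius `ρ` around `c`, and `ρ` is comparable to the diameter of `T`
with the constant `K`. -/
structure IsInscribed {d : ℕ} (K : ℝ) (T : Finset (Pt d)) (c : Pt d) (ρ : ℝ) : Prop where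
  pos : 0 < ρ
  ball_subset : Metric.closedBall c ρ ⊆ hull T
  diam_le : Metric.diam (hull T) ≤ K * ρ
  le_diam : ρ ≤ Metric.diam (hull T)

lemma volume_hull_ne_top {d : ℕ} (T : Finset (Pt d)) : volume (hull T) ≠ ⊤ :=
  (isCompact_hull T).measure_lt_top.ne

namespace IsInscribed

variable {d : ℕ} {K : ℝ} {T : Finset (Pt d)} {c : Pt d} {ρ : ℝ}

lemma one_le (h : IsInscribed K T c ρ) : 1 ≤ K :=
  le_of_mul_le_mul_right (by rw [one_mul]; exact h.le_diam.trans h.diam_le) h.pos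

lemma center_mem (h : IsInscribed K T c ρ) : c ∈ hull T :=
  h.ball_subset (Metric.mem_closedBall_self h.pos.le)

lemma le_cellVol (h : IsInscribed K T c ρ) : unitBallVol d * ρ ^ d ≤ cellVol T := by
  rw [← volume_real_closedBall c h.pos.le]
  exact measureReal_mono h.ball_subset (volume_hull_ne_top T)

lemma dist_le (h : IsInscribed K T c ρ) {x : Pt d} (hx : x ∈ hull T) :
    dist x c ≤ Metric.diam (hull T) :=
  Metric.dist_le_diam_of_mem (isCompact_hull T).isBounded hx h.center_mem

lemma cellVol_le (h : IsInscribed K T c ρ) :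
    cellVol T ≤ unitBallVol d * Metric.diam (hull T) ^ d := by
  rw [← volume_real_closedBall c Metric.diam_nonneg]
  exact measureReal_mono (fun x hx => Metric.mem_closedBall.2 (h.dist_le hx))
    measure_closedBall_lt_top.ne

lemma cellVol_le' (h : IsInscribed K T c ρ) :
    cellVol T ≤ K ^ d * (unitBallVol d * ρ ^ d) := by
  refine h.cellVol_le.trans ?_
  calc unitBallVol d * Metric.diam (hull T) ^ d ≤ unitBallVol d * (K * ρ) ^ d :=
        mul_le_mul_of_nonneg_left (pow_le_pow_left₀ Metric.diam_nonneg h.diam_le d)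
          (unitBallVol_pos d).le
    _ = _ := by rw [mul_pow]; ring

end IsInscribed

lemma cellVol_nonneg {d : ℕ} (T : Finset (Pt d)) : 0 ≤ cellVol T := measureReal_nonneg

lemma facetArea_nonneg {d : ℕ} (F : Finset (Pt d)) : 0 ≤ facetArea F := measureReal_nonneg

lemma Mesh.ShapeRegular.exists_isInscribed {d : ℕ} {M : Mesh d} {κ : ℝ} (hd : 2 ≤ d)
    (h : M.ShapeRegular κ) {T : Finset (Pt d)} (hT : T ∈ M.cells) :
    ∃ c ρ, IsInscribed (max κ 1) T c ρ := by
  obtain ⟨c, ρ, hρ, hdiam, hb⟩ := h T hT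
  refine ⟨c, ρ, hρ, hb, hdiam.trans (by gcongr; exact le_max_left _ _), ?_⟩
  obtain ⟨l, hl⟩ := M.isBarycentric hT
  obtain ⟨x, hx, y, hy, hxy⟩ := Finset.one_lt_card.1 (by rw [M.card_eq T hT]; omega : 1 < T.card)
  have h1 := hl.two_mul_le_dist hρ hb hx hy hxy
  have h2 := Metric.dist_le_diam_of_mem (isCompact_hull T).isBounded (mem_hull_self hx)
    (mem_hull_self hy)
  linarith

/-- Two cells sharing a facet have comparable diameters, since they share an edge. -/
lemma diam_le_of_common_facet {d : ℕ} {M : Mesh d} {K : ℝ} (hd : 2 ≤ d) {S T F : Finset (Pt d)}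
    (hS : S ∈ M.cells) (hFS : F ⊆ S) (hFT : F ⊆ T) (hFc : F.card = d)
    {c : Pt d} {ρ : ℝ} (h : IsInscribed K S c ρ) :
    Metric.diam (hull S) ≤ K * Metric.diam (hull T) := by
  obtain ⟨l, hl⟩ := M.isBarycentric hS
  obtain ⟨x, hx, y, hy, hxy⟩ := Finset.one_lt_card.1 (by omega : 1 < F.card)
  have h1 := hl.two_mul_le_dist h.pos h.ball_subset (hFS hx) (hFS hy) hxy
  have h2 := Metric.dist_le_diam_of_mem (isCompact_hull T).isBounded (mem_hull_self (hFT hx))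
    (mem_hull_self (hFT hy))
  have h3 := h.pos
  have h4 := h.one_le
  refine h.diam_le.trans ?_
  gcongr
  linarith

/-- Comparison, with the constant `C`, of the sizes of an interior facet and its two cells. -/
structure SizeBounds {d : ℕ} (M : Mesh d) (C : ℝ) (S T F : Finset (Pt d)) : Prop where
  diam_le : Metric.diam (hull S) ≤ C * M.facetSize F
  facetSize_le : M.facetSize F ≤ C * Metric.diam (hull S)
  vol_le : cellVol S ≤ C * (M.facetSize F * facetArea F)
  le_vol : M.facetSize F * facetArea F ≤ C * cellVol S
  vol_le_vol : cellVol S ≤ C * cellVol T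

lemma exists_sizeBounds {d : ℕ} (hd : 2 ≤ d) (κ : ℝ) : ∃ C : ℝ, 1 ≤ C ∧
    ∀ M : Mesh d, M.ShapeRegular κ → ∀ S T F : Finset (Pt d), S ∈ M.cells → T ∈ M.cells →
      S ≠ T → F ⊆ S → F ⊆ T → F ∈ M.interiorFacets →
      ∀ n : Pt d, ‖n‖ = 1 → (∀ x ∈ F, ∀ y ∈ F, inner ℝ n (x - y) = 0) → SizeBounds M C S T F := by
  set K := max κ 1 with hK
  have hK1 : 1 ≤ K := le_max_right _ _
  have hK0 : 0 ≤ K := by linarith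
  have hω := unitBallVol_pos d
  have hσ := unitBallVol_pos (d - 1)
  obtain ⟨e, rfl⟩ : ∃ e, d = e + 1 := ⟨d - 1, by omega⟩
  simp only [Nat.add_sub_cancel] at hσ
  set ω := unitBallVol (e + 1)
  set σ := unitBallVol e
  set C1 := ω / σ * (2 * K ^ e)
  set C2 := σ / ω * K ^ (e + 2)
  set C3 := K ^ (e + 1) * K ^ (e + 1)
  have h1 : 0 ≤ C1 := by positivity
  have h2 : 0 ≤ C2 := by positivity
  have h3 : 0 ≤ C3 := by positivity
  refine ⟨2 * K + C1 + C2 + C3, by linarith, ?_⟩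
  intro M hM S T F hS hT hST hFS hFT hF n hn hnF
  have hFc := Mesh.card_of_mem_interiorFacets hF
  obtain ⟨c, ρ, hin⟩ := hM.exists_isInscribed hd hS
  obtain ⟨c', ρ', hin'⟩ := hM.exists_isInscribed hd hT
  have hSdT := diam_le_of_common_facet hd hS hFS hFT hFc hin
  have hTdS := diam_le_of_common_facet hd hT hFT hFS hFc hin'
  rw [← hK] at hSdT hTdS
  have hdS : 0 ≤ Metric.diam (hull S) := Metric.diam_nonneg
  have hdT : 0 ≤ Metric.diam (hull T) := Metric.diam_nonneg
  have hρ := hin.pos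
  have hsize : M.facetSize F = (Metric.diam (hull S) + Metric.diam (hull T)) / 2 := by
    classical
    have hsub : ({S, T} : Finset (Finset (Pt (e + 1)))) ⊆ M.patch F := by
      intro R hR
      rcases Finset.mem_insert.1 hR with rfl | hR
      · exact Mesh.mem_patch.2 ⟨hS, hFS⟩
      · rw [Finset.mem_singleton.1 hR]
        exact Mesh.mem_patch.2 ⟨hT, hFT⟩
    have h2 := (Mesh.mem_interiorFacets.1 hF).2
    have heq : M.patch F = {S, T} :=
      (Finset.eq_of_subset_of_card_le hsub (by rw [h2, Finset.card_pair hST])).symm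
    rw [Mesh.facetSize, h2, heq, Finset.sum_pair hST]
    norm_num
  have hsize0 : 0 ≤ M.facetSize F := by rw [hsize]; positivity
  have hdS2 : Metric.diam (hull S) ≤ 2 * M.facetSize F := by rw [hsize]; linarith
  have hsizeS : M.facetSize F ≤ K * Metric.diam (hull S) := by
    rw [hsize]
    nlinarith
  have hA0 := facetArea_nonneg F
  have hA1 : σ * ρ ^ e ≤ facetArea F :=
    le_measureReal_hull_facet (by omega) (M.card_eq S hS) (M.indep S hS) hFS hFc hn hnF hρ
      hin.ball_subset
  obtain ⟨p, hp⟩ := Finset.card_pos.1 (by omega : 0 < F.card)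
  have hA2 : facetArea F ≤ σ * Metric.diam (hull S) ^ e :=
    measureReal_hull_facet_le hn hFS hnF hp
  have hV1 := hin.le_cellVol
  have hV2 := hin.cellVol_le
  have hup : ∀ {a b c : ℝ}, 0 ≤ b → a ≤ c * b → c ≤ 2 * K + C1 + C2 + C3 →
      a ≤ (2 * K + C1 + C2 + C3) * b := fun hb h h' => h.trans (mul_le_mul_of_nonneg_right h' hb)
  refine ⟨hup hsize0 hdS2 (by linarith), hup hdS hsizeS (by linarith),
    hup (mul_nonneg hsize0 hA0) ?_ (by linarith : C1 ≤ _),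
    hup (cellVol_nonneg S) ?_ (by linarith : C2 ≤ _),
    hup (cellVol_nonneg T) ?_ (by linarith : C3 ≤ _)⟩
  · calc cellVol S ≤ ω * Metric.diam (hull S) ^ (e + 1) := hV2
      _ = ω * (Metric.diam (hull S) * Metric.diam (hull S) ^ e) := by ring
      _ ≤ ω * (2 * M.facetSize F * (K * ρ) ^ e) := by
        gcongr
        exact hin.diam_le
      _ = C1 * (M.facetSize F * (σ * ρ ^ e)) := by
        simp only [C1]
        rw [mul_pow]
        field_simp
      _ ≤ C1 * (M.facetSize F * facetArea F) := by gcongr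
  · calc M.facetSize F * facetArea F
        ≤ (K * Metric.diam (hull S)) * (σ * Metric.diam (hull S) ^ e) := by gcongr
      _ ≤ (K * (K * ρ)) * (σ * (K * ρ) ^ e) := by
        have := hin.diam_le
        gcongr
      _ = C2 * (ω * ρ ^ (e + 1)) := by
        simp only [C2]
        rw [mul_pow]
        field_simp
        ring
      _ ≤ C2 * cellVol S := by gcongr
  · calc cellVol S ≤ ω * Metric.diam (hull S) ^ (e + 1) := hV2
      _ ≤ ω * (K * (K * ρ')) ^ (e + 1) := by
        have := hin'.diam_le
        gcongr
        exact hSdT.trans (by gcongr)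
      _ = C3 * (ω * ρ' ^ (e + 1)) := by
        simp only [C3]
        rw [mul_pow, mul_pow]
        ring
      _ ≤ C3 * cellVol T := by
        have := hin'.le_cellVol
        gcongr

/-! ### Affine functions on a cell -/

section Affine

variable {d : ℕ} {f : Pt d → ℝ} {g : Pt d}

/-- An affine function is at least `|f c| + |g| r / 2` in absolute value on a ball of radius
`r / 4` inside the ball of radius `r` around `c`, namely the one whose centre is obtained from `c`
by moving along the gradient `g`, in the direction given by the sign of `f c`. -/
lemma le_setIntegral_sq_of_affine (hf : ∀ x y, f x = f y + inner ℝ g (x - y)) {D : Set (Pt d)}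
    (hint : IntegrableOn (fun x => f x ^ 2) D) {c : Pt d} {r : ℝ}
    (hr : 0 < r) (hb : Metric.closedBall c r ⊆ D) :
    (|f c| + ‖g‖ * r / 2) ^ 2 * (unitBallVol d * (r / 4) ^ d) ≤ ∫ x in D, f x ^ 2 := by
  obtain ⟨u, hu, hgu⟩ : ∃ u : Pt d, ‖u‖ ≤ 1 ∧ inner ℝ g u = ‖g‖ := by
    by_cases hg : g = 0
    · exact ⟨0, by simp, by simp [hg]⟩
    · have hg' : ‖g‖ ≠ 0 := norm_ne_zero_iff.2 hg
      refine ⟨‖g‖⁻¹ • g, by rw [norm_smul, norm_inv, norm_norm, inv_mul_cancel₀ hg'], ?_⟩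
      rw [inner_smul_right, real_inner_self_eq_norm_sq]
      field_simp
  obtain ⟨s, hs, hs1, hsf⟩ : ∃ s : ℝ, |s| = 1 ∧ s * s = 1 ∧ s * f c = |f c| := by
    rcases abs_cases (f c) with ⟨h, _⟩ | ⟨h, _⟩
    · exact ⟨1, by simp, by simp, by rw [h, one_mul]⟩
    · exact ⟨-1, by simp, by simp, by rw [h, neg_one_mul]⟩
  set c' := c + (s * (3 / 4 * r)) • u with hc'
  have hsub : Metric.closedBall c' (r / 4) ⊆ Metric.closedBall c r := by
    refine Metric.closedBall_subset_closedBall' ?_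
    rw [dist_eq_norm, hc', add_sub_cancel_left, norm_smul, Real.norm_eq_abs, abs_mul, hs,
      abs_of_pos (by positivity)]
    nlinarith
  have hlow : ∀ x ∈ Metric.closedBall c' (r / 4), (|f c| + ‖g‖ * r / 2) ^ 2 ≤ f x ^ 2 := by
    intro x hx
    have h1 : f x = f c + s * (3 / 4 * r) * ‖g‖ + inner ℝ g (x - c') := by
      rw [hf x c', hf c' c, hc', add_sub_cancel_left, inner_smul_right, hgu]
    have h2 : |inner ℝ g (x - c')| ≤ ‖g‖ * (r / 4) :=
      (abs_real_inner_le_norm _ _).trans (mul_le_mul_of_nonneg_left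
        (by rwa [Metric.mem_closedBall, dist_eq_norm] at hx) (norm_nonneg g))
    have h3 : s * f x = |f c| + 3 / 4 * r * ‖g‖ + s * inner ℝ g (x - c') := by
      rw [h1, ← hsf]
      linear_combination (3 / 4 * r * ‖g‖) * hs1
    have h4 : |s * inner ℝ g (x - c')| ≤ ‖g‖ * (r / 4) := by rwa [abs_mul, hs, one_mul]
    have h5 : |f c| + ‖g‖ * r / 2 ≤ s * f x := by
      rw [h3]
      have := neg_le_of_abs_le h4
      linarith
    have h6 : f x ^ 2 = (s * f x) ^ 2 := by
      linear_combination (-(f x) ^ 2) * hs1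
    rw [h6]
    exact pow_le_pow_left₀ (by positivity) h5 2
  rw [← volume_real_closedBall c' (by positivity : 0 ≤ r / 4)]
  calc (|f c| + ‖g‖ * r / 2) ^ 2 * volume.real (Metric.closedBall c' (r / 4))
      = ∫ _ in Metric.closedBall c' (r / 4), (|f c| + ‖g‖ * r / 2) ^ 2 := by
        rw [setIntegral_const, smul_eq_mul, mul_comm]
    _ ≤ ∫ x in Metric.closedBall c' (r / 4), f x ^ 2 :=
        setIntegral_mono_on (integrableOn_const measure_closedBall_lt_top.ne)
          (hint.mono_set (hsub.trans hb)) Metric.isClosed_closedBall.measurableSet hlow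
    _ ≤ ∫ x in D, f x ^ 2 :=
        setIntegral_mono_set hint (ae_of_all _ fun x => sq_nonneg _)
          (hsub.trans hb).eventuallyLE

lemma continuous_of_affine (hf : ∀ x y, f x = f y + inner ℝ g (x - y)) : Continuous f := by
  have : f = fun x => f 0 + inner ℝ g (x - 0) := funext fun x => hf x 0
  rw [this]
  fun_prop

lemma integrableOn_hull_of_continuous {f : Pt d → ℝ} (hf : Continuous f) (T : Finset (Pt d)) :
    IntegrableOn f (hull T) :=
  hf.continuousOn.integrableOn_compact (isCompact_hull T)

/-- The inverse estimate: the gradient of an affine function is controlled by its `L²` norm. -/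
lemma norm_sq_mul_le_setIntegral (hf : ∀ x y, f x = f y + inner ℝ g (x - y)) {K : ℝ}
    {T : Finset (Pt d)} {c : Pt d} {ρ : ℝ} (h : IsInscribed K T c ρ) :
    ‖g‖ ^ 2 * (Metric.diam (hull T) ^ 2 * cellVol T) ≤
      (4 * K ^ 2 * K ^ d * 4 ^ d) * ∫ x in hull T, f x ^ 2 := by
  have hK : 0 ≤ K := by linarith [h.one_le]
  have hρ := h.pos
  have hω := unitBallVol_pos d
  have h1 := le_setIntegral_sq_of_affine hf
    (integrableOn_hull_of_continuous ((continuous_of_affine hf).pow 2) T) hρ h.ball_subset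
  calc ‖g‖ ^ 2 * (Metric.diam (hull T) ^ 2 * cellVol T)
      ≤ ‖g‖ ^ 2 * ((K * ρ) ^ 2 * (K ^ d * (unitBallVol d * ρ ^ d))) := by
        have := h.cellVol_le'
        have := h.diam_le
        have := Metric.diam_nonneg (s := hull T)
        have := cellVol_nonneg T
        gcongr
    _ = (4 * K ^ 2 * K ^ d * 4 ^ d) * ((0 + ‖g‖ * ρ / 2) ^ 2 * (unitBallVol d * (ρ / 4) ^ d)) := by
        rw [div_pow]
        field_simp
        ring
    _ ≤ (4 * K ^ 2 * K ^ d * 4 ^ d) *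
          ((|f c| + ‖g‖ * ρ / 2) ^ 2 * (unitBallVol d * (ρ / 4) ^ d)) := by
        gcongr
        positivity
    _ ≤ _ := by gcongr

/-- The extension of an affine function from a cell `T` to a neighbouring cell `S` is controlled by
its `L²` norm on `T`. -/
lemma setIntegral_sq_le_of_affine (hf : ∀ x y, f x = f y + inner ℝ g (x - y)) {K C : ℝ}
    {S T : Finset (Pt d)} {c : Pt d} {ρ : ℝ} (h : IsInscribed K T c ρ)
    (hST : Metric.diam (hull S) ≤ K * Metric.diam (hull T)) (hne : (hull S ∩ hull T).Nonempty)
    (hC : 0 ≤ C) (hV : cellVol S ≤ C * cellVol T) :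
    ∫ x in hull S, f x ^ 2 ≤ (16 * K ^ 4 * C * K ^ d * 4 ^ d) * ∫ x in hull T, f x ^ 2 := by
  have hK1 := h.one_le
  have hK : 0 ≤ K := by linarith
  have hρ := h.pos
  have hω := unitBallVol_pos d
  have h1 := le_setIntegral_sq_of_affine hf
    (integrableOn_hull_of_continuous ((continuous_of_affine hf).pow 2) T) hρ h.ball_subset
  obtain ⟨p, hpS, hpT⟩ := hne
  have hup : ∀ x ∈ hull S, f x ^ 2 ≤ (4 * K ^ 2 * (|f c| + ‖g‖ * ρ / 2)) ^ 2 := by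
    intro x hx
    have h2 : dist x c ≤ 2 * K ^ 2 * ρ := by
      have h3 := dist_triangle x p c
      have h4 := Metric.dist_le_diam_of_mem (isCompact_hull S).isBounded hx hpS
      have h5 := h.dist_le hpT
      have h6 := h.diam_le
      have h7 : K * Metric.diam (hull T) ≤ K * (K * ρ) := by gcongr
      have h8 : Metric.diam (hull T) ≤ K * Metric.diam (hull T) :=
        le_mul_of_one_le_left Metric.diam_nonneg hK1
      calc dist x c ≤ K * (K * ρ) + K * (K * ρ) := by linarith
        _ = 2 * K ^ 2 * ρ := by ring
    have h3 : |f x| ≤ |f c| + ‖g‖ * (2 * K ^ 2 * ρ) := by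
      rw [hf x c]
      refine (abs_add_le _ _).trans (add_le_add_right ?_ _)
      refine (abs_real_inner_le_norm _ _).trans ?_
      rw [← dist_eq_norm]
      gcongr
    have h4 : |f x| ≤ 4 * K ^ 2 * (|f c| + ‖g‖ * ρ / 2) := by
      have : 1 ≤ K ^ 2 := one_le_pow₀ hK1
      have := mul_le_mul_of_nonneg_right (by linarith : (1 : ℝ) ≤ 4 * K ^ 2) (abs_nonneg (f c))
      linarith
    rw [← sq_abs]
    exact pow_le_pow_left₀ (abs_nonneg _) h4 2
  calc ∫ x in hull S, f x ^ 2
      ≤ ∫ _ in hull S, (4 * K ^ 2 * (|f c| + ‖g‖ * ρ / 2)) ^ 2 :=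
        setIntegral_mono_on (integrableOn_hull_of_continuous ((continuous_of_affine hf).pow 2) S)
          (integrableOn_const (volume_hull_ne_top S)) (measurableSet_hull S) hup
    _ = (4 * K ^ 2 * (|f c| + ‖g‖ * ρ / 2)) ^ 2 * cellVol S := by
        rw [setIntegral_const, smul_eq_mul, mul_comm, cellVol]
    _ ≤ (4 * K ^ 2 * (|f c| + ‖g‖ * ρ / 2)) ^ 2 * (C * (K ^ d * (unitBallVol d * ρ ^ d))) := by
        have := h.cellVol_le'
        gcongr
        exact hV.trans (by gcongr)
    _ = (16 * K ^ 4 * C * K ^ d * 4 ^ d) *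
          ((|f c| + ‖g‖ * ρ / 2) ^ 2 * (unitBallVol d * (ρ / 4) ^ d)) := by
        rw [div_pow]
        field_simp
        ring
    _ ≤ _ := by gcongr

end Affine

namespace Mesh

/-! ### Summation along walks of cells -/

variable {d : ℕ} {M : Mesh d} {Ω : Set (Pt d)}

lemma mem_cutFacets {F : Finset (Pt d)} : F ∈ M.cutFacets Ω ↔
    F ∈ M.interiorFacets ∧ ∃ T ∈ M.patch F, T ∈ M.cutCells Ω := by
  simp [cutFacets]

open scoped Classical in
/-- Each cell has at most `d + 1` facets. -/
lemma sum_cutFacets_filter_le {a : Finset (Pt d) → ℝ} {T : Finset (Pt d)} (hT : T ∈ M.cells)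
    (ha : 0 ≤ a T) : ∑ F ∈ M.cutFacets Ω, (if F ⊆ T then a T else 0) ≤ (d + 1) * a T := by
  rw [← Finset.sum_filter, Finset.sum_const, nsmul_eq_mul]
  refine mul_le_mul_of_nonneg_right ?_ ha
  have h1 : (M.cutFacets Ω).filter (fun F => F ⊆ T) ⊆ T.powersetCard d := by
    intro F hF
    rw [Finset.mem_filter, mem_cutFacets] at hF
    exact Finset.mem_powersetCard.2 ⟨hF.2, card_of_mem_interiorFacets hF.1.1⟩
  have h2 := Finset.card_le_card h1
  rw [Finset.card_powersetCard, M.card_eq T hT, Nat.choose_succ_self_right] at h2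
  exact_mod_cast h2

lemma sum_cutFacets_le {a j : Finset (Pt d) → ℝ} {K : ℝ} (hK : 0 ≤ K)
    (ha : ∀ T ∈ M.cells, 0 ≤ a T)
    (hj : ∀ F ∈ M.cutFacets Ω, j F ≤ K * ∑ T ∈ M.patch F, a T) :
    ∑ F ∈ M.cutFacets Ω, j F ≤ K * ((d + 1) * ∑ T ∈ M.cells, a T) := by
  classical
  calc ∑ F ∈ M.cutFacets Ω, j F ≤ ∑ F ∈ M.cutFacets Ω, K * ∑ T ∈ M.patch F, a T :=
        Finset.sum_le_sum hj
    _ = K * ∑ T ∈ M.cells, ∑ F ∈ M.cutFacets Ω, (if F ⊆ T then a T else 0) := by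
        rw [← Finset.mul_sum, Finset.sum_comm]
        congr 1
        refine Finset.sum_congr rfl fun F _ => ?_
        rw [patch, Finset.sum_filter]
    _ ≤ K * ∑ T ∈ M.cells, (d + 1) * a T := by
        gcongr with T hT
        exact sum_cutFacets_filter_le hT (ha T hT)
    _ = K * ((d + 1) * ∑ T ∈ M.cells, a T) := by rw [← Finset.mul_sum]

open scoped Classical in
/-- The cells from which a cell not meeting the boundary is reached in at most `k` steps across
interior facets, all steps starting from cut cells. -/
noncomputable def layer (M : Mesh d) (Ω : Set (Pt d)) : ℕ → Finset (Finset (Pt d))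
  | 0 => M.cells.filter (fun T => T ∉ M.cutCells Ω)
  | k + 1 => layer M Ω k ∪
      (M.cutCells Ω).filter (fun T => ∃ T' ∈ layer M Ω k, T ∩ T' ∈ M.interiorFacets)

lemma layer_subset_cells (k : ℕ) : M.layer Ω k ⊆ M.cells := by
  classical
  induction k with
  | zero => exact Finset.filter_subset _ _
  | succ k ih =>
    refine Finset.union_subset ih ((Finset.filter_subset _ _).trans fun T hT => ?_)
    exact (mem_cutCells.1 hT).1

lemma layer_mono : Monotone (M.layer Ω) := by
  classical
  exact monotone_nat_of_le_succ fun k => Finset.subset_union_left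

open scoped Classical in
lemma mem_layer_of_walk (m : ℕ) : ∀ S : ℕ → Finset (Pt d), (∀ i ≤ m, S i ∈ M.cells) →
    (∀ i < m, S i ∩ S (i + 1) ∈ M.interiorFacets) → S m ∉ M.cutCells Ω →
    S 0 ∈ M.layer Ω m := by
  induction m with
  | zero =>
    intro S hS _ hm
    exact Finset.mem_filter.2 ⟨hS 0 le_rfl, hm⟩
  | succ m ih =>
    intro S hS hF hm
    by_cases h0 : S 0 ∈ M.cutCells Ω
    · have h1 := ih (fun i => S (i + 1)) (fun i hi => hS (i + 1) (by omega))
        (fun i hi => hF (i + 1) (by omega)) hm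
      exact Finset.mem_union_right _ (Finset.mem_filter.2 ⟨h0, S 1, h1, hF 0 (by omega)⟩)
    · exact layer_mono (Nat.zero_le _) (Finset.mem_filter.2 ⟨hS 0 (by omega), h0⟩)

lemma BoundedWalk.layer_eq {N : ℕ} (h : M.BoundedWalk Ω N) : M.layer Ω N = M.cells := by
  classical
  refine (layer_subset_cells N).antisymm fun T hT => ?_
  by_cases hcut : T ∈ M.cutCells Ω
  · obtain ⟨T', _, hT', m, S, hm, rfl, rfl, hS, hF⟩ := h T hcut
    refine layer_mono (by omega : m ≤ N) (mem_layer_of_walk m S hS (fun i hi => ?_) hT')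
    convert hF i hi
  · exact layer_mono (Nat.zero_le N) (Finset.mem_filter.2 ⟨hT, hcut⟩)

/-- One step of the walk. Every cell is reached from at most `d + 1` others and every facet is
crossed by at most two cells, so the multiplicities are bounded by the dimension. -/
lemma sum_layer_succ_le {a j : Finset (Pt d) → ℝ} {K : ℝ} (hK : 0 ≤ K)
    (ha : ∀ T ∈ M.cells, 0 ≤ a T) (hj : ∀ F ∈ M.cutFacets Ω, 0 ≤ j F)
    (hstep : ∀ F ∈ M.interiorFacets, ∀ S ∈ M.cells, ∀ T ∈ M.cells, F ⊆ S → F ⊆ T → S ≠ T →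
      a S ≤ K * (a T + j F)) (k : ℕ) :
    ∑ T ∈ M.layer Ω (k + 1), a T ≤ ∑ T ∈ M.layer Ω k, a T +
      K * (2 * ((d + 1) * ∑ T ∈ M.layer Ω k, a T + ∑ F ∈ M.cutFacets Ω, j F)) := by
  classical
  set B := M.layer Ω k
  set A := (M.cutCells Ω).filter (fun T => ∃ T' ∈ B, T ∩ T' ∈ M.interiorFacets) with hA
  have hB : B ⊆ M.cells := layer_subset_cells k
  have hAc : A ⊆ M.cells := fun T hT => (mem_cutCells.1 (Finset.mem_filter.1 hT).1).1
  -- the contribution of a facet to each of the cells adjacent to it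
  set w : Finset (Pt d) → ℝ := fun F => ∑ T ∈ B, (if F ⊆ T then a T else 0) + j F
  have hw1 : ∀ F, 0 ≤ ∑ T ∈ B, (if F ⊆ T then a T else 0) := fun F =>
    Finset.sum_nonneg fun T hT => by
      split_ifs
      · exact ha T (hB hT)
      · exact le_rfl
  have hw : ∀ F ∈ M.cutFacets Ω, 0 ≤ w F := fun F hF => add_nonneg (hw1 F) (hj F hF)
  have h1 : ∀ S ∈ A, a S ≤ K * ∑ F ∈ M.cutFacets Ω, (if F ⊆ S then w F else 0) := by
    intro S hS
    obtain ⟨hcut, T, hT, hF⟩ := Finset.mem_filter.1 hS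
    have hST : S ≠ T := by
      rintro rfl
      have := card_of_mem_interiorFacets hF
      rw [Finset.inter_self, M.card_eq S (hAc hS)] at this
      omega
    have hFS : S ∩ T ⊆ S := Finset.inter_subset_left
    have hFT : S ∩ T ⊆ T := Finset.inter_subset_right
    have hFc : S ∩ T ∈ M.cutFacets Ω :=
      mem_cutFacets.2 ⟨hF, S, mem_patch.2 ⟨hAc hS, hFS⟩, hcut⟩
    refine (hstep _ hF S (hAc hS) T (hB hT) hFS hFT hST).trans (mul_le_mul_of_nonneg_left ?_ hK)
    have h2 : a T ≤ ∑ R ∈ B, (if S ∩ T ⊆ R then a R else 0) := by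
      have := Finset.single_le_sum (s := B) (f := fun R => if S ∩ T ⊆ R then a R else 0)
        (fun R hR => by
          split_ifs
          · exact ha R (hB hR)
          · exact le_rfl) hT
      simpa [hFT] using this
    have h3 : w (S ∩ T) ≤ ∑ F ∈ M.cutFacets Ω, (if F ⊆ S then w F else 0) := by
      have := Finset.single_le_sum (s := M.cutFacets Ω) (f := fun F => if F ⊆ S then w F else 0)
        (fun F hF => by
          split_ifs
          · exact hw F hF
          · exact le_rfl) hFc
      simpa [hFS] using this
    exact (add_le_add_left h2 _).trans h3
  have h2 : ∑ S ∈ A, a S ≤ K * ∑ F ∈ M.cutFacets Ω, 2 * w F := by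
    calc ∑ S ∈ A, a S ≤ ∑ S ∈ A, K * ∑ F ∈ M.cutFacets Ω, (if F ⊆ S then w F else 0) :=
          Finset.sum_le_sum h1
      _ = K * ∑ F ∈ M.cutFacets Ω, ∑ S ∈ A, (if F ⊆ S then w F else 0) := by
          rw [← Finset.mul_sum, Finset.sum_comm]
      _ ≤ K * ∑ F ∈ M.cutFacets Ω, 2 * w F := by
          gcongr with F hF
          rw [← Finset.sum_filter, Finset.sum_const, nsmul_eq_mul]
          refine mul_le_mul_of_nonneg_right ?_ (hw F hF)
          have h3 : A.filter (fun S => F ⊆ S) ⊆ M.patch F := fun S hS => by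
            rw [Finset.mem_filter] at hS
            exact mem_patch.2 ⟨hAc hS.1, hS.2⟩
          have h4 := Finset.card_le_card h3
          rw [(mem_interiorFacets.1 (mem_cutFacets.1 hF).1).2] at h4
          exact_mod_cast h4
  have h3 : ∑ F ∈ M.cutFacets Ω, 2 * w F ≤
      2 * ((d + 1) * ∑ T ∈ B, a T + ∑ F ∈ M.cutFacets Ω, j F) := by
    rw [← Finset.mul_sum, Finset.sum_add_distrib, Finset.sum_comm, Finset.mul_sum (s := B)]
    gcongr with T hT
    exact sum_cutFacets_filter_le (hB hT) (ha T (hB hT))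
  have h4 : ∑ T ∈ M.layer Ω (k + 1), a T ≤ ∑ T ∈ B, a T + ∑ S ∈ A, a S := by
    have h5 : M.layer Ω (k + 1) = B ∪ A := rfl
    rw [h5, ← Finset.sum_union_inter]
    exact le_add_of_nonneg_right (Finset.sum_nonneg fun T hT => ha T (hB (Finset.mem_inter.1 hT).1))
  refine h4.trans (add_le_add_right (h2.trans ?_) _)
  exact mul_le_mul_of_nonneg_left h3 hK

/-- A quantity that can be controlled on a cell by its value on a neighbour and a contribution of
the common facet can be controlled on all cells by its values on the cells not meeting the boundary
and the contributions of the facets of cut cells. -/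
lemma BoundedWalk.sum_cells_le {N : ℕ} (h : M.BoundedWalk Ω N) {a j : Finset (Pt d) → ℝ} {K : ℝ}
    (hK : 0 ≤ K) (ha : ∀ T ∈ M.cells, 0 ≤ a T) (hj : ∀ F ∈ M.cutFacets Ω, 0 ≤ j F)
    (hstep : ∀ F ∈ M.interiorFacets, ∀ S ∈ M.cells, ∀ T ∈ M.cells, F ⊆ S → F ⊆ T → S ≠ T →
      a S ≤ K * (a T + j F)) :
    ∑ T ∈ M.cells, a T ≤ (2 + 2 * K * (d + 1)) ^ N *
      (∑ T ∈ M.layer Ω 0, a T + ∑ F ∈ M.cutFacets Ω, j F) := by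
  have hJ : 0 ≤ ∑ F ∈ M.cutFacets Ω, j F := Finset.sum_nonneg hj
  have key : ∀ k, ∑ T ∈ M.layer Ω k, a T + ∑ F ∈ M.cutFacets Ω, j F ≤
      (2 + 2 * K * (d + 1)) ^ k * (∑ T ∈ M.layer Ω 0, a T + ∑ F ∈ M.cutFacets Ω, j F) := by
    intro k
    induction k with
    | zero => simp
    | succ k ih =>
      have h1 := sum_layer_succ_le hK ha hj hstep k
      have h2 : 0 ≤ ∑ T ∈ M.layer Ω k, a T :=
        Finset.sum_nonneg fun T hT => ha T (layer_subset_cells k hT)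
      have h3 : 0 ≤ K * d * ∑ F ∈ M.cutFacets Ω, j F := by positivity
      rw [pow_succ']
      rw [mul_assoc]
      refine le_trans ?_ (mul_le_mul_of_nonneg_left ih (by positivity))
      linarith
  have := key N
  rw [h.layer_eq] at this
  linarith

end Mesh

/-! ### Equivalence of energies -/

/-- The nonnegative quantities `x` and `y` bound each other up to the factor `C`. -/
def EquivWith (C x y : ℝ) : Prop := 0 ≤ x ∧ 0 ≤ y ∧ x ≤ C * y ∧ y ≤ C * x

lemma EquivWith.mono {C C' x y : ℝ} (h : EquivWith C x y) (hC : C ≤ C') : EquivWith C' x y :=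
  ⟨h.1, h.2.1, h.2.2.1.trans (mul_le_mul_of_nonneg_right hC h.2.1),
    h.2.2.2.trans (mul_le_mul_of_nonneg_right hC h.1)⟩

/-- The constant of the global estimates when the local ones hold with constant `K` and walks have
at most `N` cells: the first summand comes from iterating the local estimate along the walks, the
second from the number of facets of a cell. -/
noncomputable def walkConst (d N : ℕ) (K : ℝ) : ℝ := (2 + 2 * K * (d + 1)) ^ N + (1 + K * (d + 1))

/-- The passage from local to global estimates, for a density `f` and facet terms `j`. -/
lemma Mesh.BoundedWalk.equivWith {d : ℕ} {M : Mesh d} {Ω : Set (Pt d)} {N : ℕ}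
    (h : M.BoundedWalk Ω N) (hΩ : IsOpen Ω) (hsub : Ω ⊆ M.domain)
    (hne : ∀ T ∈ M.cells, (hull T ∩ Ω).Nonempty) {f : Pt d → ℝ} (hf0 : ∀ x, 0 ≤ f x)
    (hf : ∀ T ∈ M.cells, IntegrableOn f (hull T)) {j : Finset (Pt d) → ℝ}
    (hj : ∀ F ∈ M.interiorFacets, 0 ≤ j F) {K : ℝ} (hK : 0 ≤ K)
    (hstep : ∀ F ∈ M.interiorFacets, ∀ S ∈ M.cells, ∀ T ∈ M.cells, F ⊆ S → F ⊆ T → S ≠ T →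
      ∫ x in hull S, f x ≤ K * ((∫ x in hull T, f x) + j F))
    (hinv : ∀ F ∈ M.interiorFacets, ∀ S ∈ M.cells, ∀ T ∈ M.cells, F ⊆ S → F ⊆ T → S ≠ T →
      j F ≤ K * ((∫ x in hull S, f x) + ∫ x in hull T, f x)) :
    EquivWith (walkConst d N K) (∫ x in M.domain, f x)
      ((∫ x in Ω, f x) + ∑ F ∈ M.cutFacets Ω, j F) := by
  have hcut : ∀ F ∈ M.cutFacets Ω, F ∈ M.interiorFacets := fun F hF =>
    (Mesh.mem_cutFacets.1 hF).1
  have hdom : ∫ x in M.domain, f x = ∑ T ∈ M.cells, ∫ x in hull T, f x :=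
    Mesh.setIntegral_biUnion_cells subset_rfl hf
  have hint : IntegrableOn f M.domain := Mesh.integrableOn_domain hf
  have hJ : 0 ≤ ∑ F ∈ M.cutFacets Ω, j F := Finset.sum_nonneg fun F hF => hj F (hcut F hF)
  have hΩ0 : 0 ≤ ∫ x in Ω, f x := integral_nonneg hf0
  have hD0 : 0 ≤ ∫ x in M.domain, f x := integral_nonneg hf0
  have ha : ∀ T ∈ M.cells, 0 ≤ ∫ x in hull T, f x := fun T _ => integral_nonneg hf0
  have hΩD : ∫ x in Ω, f x ≤ ∫ x in M.domain, f x :=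
    setIntegral_mono_set hint (ae_of_all _ hf0) hsub.eventuallyLE
  have hB : ∑ T ∈ M.layer Ω 0, ∫ x in hull T, f x ≤ ∫ x in Ω, f x := by
    classical
    rw [← Mesh.setIntegral_biUnion_cells (Mesh.layer_subset_cells 0) hf]
    refine setIntegral_mono_set (hint.mono_set hsub) (ae_of_all _ hf0)
      (Set.iUnion₂_subset fun T hT => ?_).eventuallyLE
    have hT' : T ∈ M.cells.filter (fun T => T ∉ M.cutCells Ω) := hT
    rw [Finset.mem_filter] at hT'
    exact Mesh.hull_subset_of_notMem_cutCells hΩ hne hT'.1 hT'.2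
  have h1 := h.sum_cells_le hK ha (fun F hF => hj F (hcut F hF)) hstep
  have h2 : ∑ F ∈ M.cutFacets Ω, j F ≤ K * ((d + 1) * ∑ T ∈ M.cells, ∫ x in hull T, f x) := by
    refine Mesh.sum_cutFacets_le hK ha fun F hF => ?_
    obtain ⟨S, T, hST, hS, hT, hFS, hFT, hsum⟩ := Mesh.exists_patch_eq (hcut F hF)
    rw [hsum fun T => ∫ x in hull T, f x]
    exact hinv F (hcut F hF) S hS T hT hFS hFT hST
  rw [← hdom] at h1 h2
  refine ⟨hD0, add_nonneg hΩ0 hJ, ?_, ?_⟩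
  · have h3 : 0 ≤ (1 + K * (d + 1)) * ((∫ x in Ω, f x) + ∑ F ∈ M.cutFacets Ω, j F) := by positivity
    rw [walkConst, add_mul]
    refine (h1.trans ?_).trans (le_add_of_nonneg_right h3)
    gcongr
  · have h3 : 0 ≤ (2 + 2 * K * (d + 1)) ^ N * ∫ x in M.domain, f x := by positivity
    rw [walkConst, add_mul]
    refine le_trans ?_ (le_add_of_nonneg_left h3)
    linarith

lemma ae_restrict_hull_mem_interior {d : ℕ} (T : Finset (Pt d)) :
    ∀ᵐ x ∂(volume : Measure (Pt d)).restrict (hull T), x ∈ interior (hull T) := by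
  have h : ∀ᵐ x ∂(volume : Measure (Pt d)).restrict (hull T), x ∉ frontier (hull T) := by
    refine ae_restrict_of_ae ?_
    rw [ae_iff]
    simpa using volume_frontier_hull T
  filter_upwards [h, ae_restrict_mem (measurableSet_hull T)] with x hx hxT
  by_contra hxi
  exact hx ⟨subset_closure hxT, hxi⟩

lemma facetSize_nonneg {d : ℕ} (M : Mesh d) (F : Finset (Pt d)) : 0 ≤ M.facetSize F :=
  div_nonneg (Finset.sum_nonneg fun _ _ => Metric.diam_nonneg) (Nat.cast_nonneg _)

lemma facetJumpSq_nonneg {d : ℕ} {W : Type*} [NormedAddCommGroup W] [NormedSpace ℝ W]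
    (F : Finset (Pt d)) (n : Pt d) (g : Pt d → W) : 0 ≤ facetJumpSq F n g :=
  integral_nonneg fun _ => sq_nonneg _

/-- The case of densities `f` that are constant on each cell, where `G T` is the value of `f` in
the interior of `T`, and `j F` is the integral over the facet `F` of a constant squared jump `J`. -/
lemma exists_equivWith_of_const {d : ℕ} (hd : 2 ≤ d) (κ : ℝ) (N : ℕ) :
    ∃ C : ℝ, ∀ (M : Mesh d) (Ω : Set (Pt d)) (n : Finset (Pt d) → Pt d), M.ShapeRegular κ →
      IsOpen Ω → Ω ⊆ M.domain → (∀ T ∈ M.cells, (hull T ∩ Ω).Nonempty) → M.BoundedWalk Ω N →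
      M.IsUnitNormalField n → ∀ (f : Pt d → ℝ) (G : Finset (Pt d) → ℝ) (j : Finset (Pt d) → ℝ),
      (∀ x, 0 ≤ f x) → (∀ F, 0 ≤ j F) →
      (∀ T ∈ M.cells, 0 ≤ G T ∧ ∀ x ∈ interior (hull T), f x = G T) →
      (∀ F ∈ M.interiorFacets, ∀ S ∈ M.cells, ∀ T ∈ M.cells, F ⊆ S → F ⊆ T → S ≠ T →
        ∃ J, 0 ≤ J ∧ j F = J * facetArea F ∧ G S ≤ 2 * G T + 2 * J ∧ J ≤ 2 * G S + 2 * G T) →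
      EquivWith C (∫ x in M.domain, f x)
        ((∫ x in Ω, f x) + ∑ F ∈ M.cutFacets Ω, M.facetSize F * j F) := by
  obtain ⟨C, hC1, hC⟩ := exists_sizeBounds hd κ
  refine ⟨walkConst d N (2 * C), ?_⟩
  intro M Ω n hM hΩ hsub hne hwalk hn f G j hf0 hj0 hG hJ
  have hae : ∀ T ∈ M.cells, f =ᵐ[volume.restrict (hull T)] fun _ => G T := fun T hT => by
    filter_upwards [ae_restrict_hull_mem_interior T] with x hx
    exact (hG T hT).2 x hx
  have hint : ∀ T ∈ M.cells, ∫ x in hull T, f x = cellVol T * G T := fun T hT => by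
    rw [integral_congr_ae (hae T hT), setIntegral_const, smul_eq_mul, cellVol]
  refine hwalk.equivWith hΩ hsub hne hf0
    (fun T hT => (integrableOn_const (volume_hull_ne_top T)).congr_fun_ae (hae T hT).symm)
    (fun F _ => mul_nonneg (facetSize_nonneg M F) (hj0 F)) (by linarith) ?_ ?_
  · intro F hF S hS T hT hFS hFT hST
    obtain ⟨J, hJ0, hjF, h1, -⟩ := hJ F hF S hS T hT hFS hFT hST
    have hb := hC M hM S T F hS hT hST hFS hFT hF (n F) (hn F hF).1 (hn F hF).2
    rw [hint S hS, hint T hT, hjF]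
    calc cellVol S * G S ≤ cellVol S * (2 * G T + 2 * J) :=
          mul_le_mul_of_nonneg_left h1 (cellVol_nonneg S)
      _ = 2 * (cellVol S * G T) + 2 * (cellVol S * J) := by ring
      _ ≤ 2 * (C * cellVol T * G T) + 2 * (C * (M.facetSize F * facetArea F) * J) := by
          have := (hG T hT).1
          have := hb.vol_le
          have := hb.vol_le_vol
          gcongr
      _ = 2 * C * (cellVol T * G T + M.facetSize F * (J * facetArea F)) := by ring
  · intro F hF S hS T hT hFS hFT hST
    obtain ⟨J, hJ0, hjF, -, h1⟩ := hJ F hF S hS T hT hFS hFT hST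
    have hb := hC M hM S T F hS hT hST hFS hFT hF (n F) (hn F hF).1 (hn F hF).2
    have hb' := hC M hM T S F hT hS hST.symm hFT hFS hF (n F) (hn F hF).1 (hn F hF).2
    rw [hint S hS, hint T hT, hjF]
    have h0 : 0 ≤ M.facetSize F * facetArea F :=
      mul_nonneg (facetSize_nonneg M F) (facetArea_nonneg F)
    calc M.facetSize F * (J * facetArea F) = M.facetSize F * facetArea F * J := by ring
      _ ≤ M.facetSize F * facetArea F * (2 * G S + 2 * G T) := mul_le_mul_of_nonneg_left h1 h0
      _ = 2 * (M.facetSize F * facetArea F * G S) + 2 * (M.facetSize F * facetArea F * G T) := by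
          ring
      _ ≤ 2 * (C * cellVol S * G S) + 2 * (C * cellVol T * G T) := by
          have := (hG T hT).1
          have := (hG S hS).1
          have := hb.le_vol
          have := hb'.le_vol
          gcongr
      _ = 2 * C * (cellVol S * G S + cellVol T * G T) := by ring

lemma norm_sq_le_two_mul {W : Type*} [SeminormedAddCommGroup W] (a b : W) :
    ‖a‖ ^ 2 ≤ 2 * ‖b‖ ^ 2 + 2 * ‖a - b‖ ^ 2 := by
  have h : ‖a‖ ≤ ‖b‖ + ‖a - b‖ := by
    have := norm_add_le b (a - b)
    rwa [add_sub_cancel] at this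
  have := pow_le_pow_left₀ (norm_nonneg a) h 2
  nlinarith [sq_nonneg (‖b‖ - ‖a - b‖)]

lemma norm_sub_sq_le_two_mul {W : Type*} [SeminormedAddCommGroup W] (a b : W) :
    ‖a - b‖ ^ 2 ≤ 2 * ‖a‖ ^ 2 + 2 * ‖b‖ ^ 2 := by
  have := pow_le_pow_left₀ (norm_nonneg (a - b)) (norm_sub_le a b) 2
  nlinarith [sq_nonneg (‖a‖ - ‖b‖)]

section Frobenius

variable {d : ℕ} {W : Type*} [NormedAddCommGroup W] [NormedSpace ℝ W]

/-- The squared Frobenius norm of a linear map on `ℝᵈ`. -/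
noncomputable def frobeniusSq (D : Pt d →ₗ[ℝ] W) : ℝ :=
  ∑ i : Fin d, ‖D (EuclideanSpace.single i (1 : ℝ))‖ ^ 2

lemma frobeniusSq_nonneg (D : Pt d →ₗ[ℝ] W) : 0 ≤ frobeniusSq D :=
  Finset.sum_nonneg fun _ _ => sq_nonneg _

lemma frobeniusSq_le_two_mul (D E : Pt d →ₗ[ℝ] W) :
    frobeniusSq D ≤ 2 * frobeniusSq E + 2 * frobeniusSq (D - E) := by
  simp only [frobeniusSq, Finset.mul_sum, ← Finset.sum_add_distrib]
  exact Finset.sum_le_sum fun i _ => norm_sq_le_two_mul _ _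

lemma sum_sq_eq_one {n : Pt d} (hn : ‖n‖ = 1) : ∑ i, n i ^ 2 = 1 := by
  rw [← EuclideanSpace.real_norm_sq_eq, hn, one_pow]

lemma norm_apply_sq_le_frobeniusSq (D : Pt d →ₗ[ℝ] W) {n : Pt d} (hn : ‖n‖ = 1) :
    ‖D n‖ ^ 2 ≤ frobeniusSq D := by
  have h1 : D n = ∑ i, n i • D (EuclideanSpace.single i (1 : ℝ)) := by
    have h2 : n = ∑ i, n i • EuclideanSpace.single i (1 : ℝ) := by
      have := (EuclideanSpace.basisFun (Fin d) ℝ).sum_repr n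
      simpa using this.symm
    conv_lhs => rw [h2]
    rw [map_sum]
    exact Finset.sum_congr rfl fun i _ => map_smul _ _ _
  have h2 : ‖D n‖ ≤ ∑ i, |n i| * ‖D (EuclideanSpace.single i (1 : ℝ))‖ := by
    rw [h1]
    refine (norm_sum_le _ _).trans (Finset.sum_le_sum fun i _ => ?_)
    rw [norm_smul, Real.norm_eq_abs]
  calc ‖D n‖ ^ 2 ≤ (∑ i, |n i| * ‖D (EuclideanSpace.single i (1 : ℝ))‖) ^ 2 :=
        pow_le_pow_left₀ (norm_nonneg _) h2 2
    _ ≤ (∑ i, |n i| ^ 2) * ∑ i, ‖D (EuclideanSpace.single i (1 : ℝ))‖ ^ 2 :=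
        Finset.sum_mul_sq_le_sq_mul_sq _ _ _
    _ = frobeniusSq D := by simp only [sq_abs, sum_sq_eq_one hn, one_mul, frobeniusSq]

lemma frobeniusSq_eq_of_rank_one (D : Pt d →ₗ[ℝ] W) {n : Pt d} (hn : ‖n‖ = 1)
    (hD : ∀ w, D w = (inner ℝ n w : ℝ) • D n) : frobeniusSq D = ‖D n‖ ^ 2 := by
  have h : ∀ i : Fin d, ‖D (EuclideanSpace.single i (1 : ℝ))‖ ^ 2 = n i ^ 2 * ‖D n‖ ^ 2 := by
    intro i
    rw [hD, norm_smul, mul_pow, Real.norm_eq_abs, sq_abs, EuclideanSpace.inner_single_right]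
    simp
  simp only [frobeniusSq, h]
  rw [← Finset.sum_mul, sum_sq_eq_one hn, one_mul]

lemma fderiv_eq_of_eqOn {T : Finset (Pt d)} {v : Pt d → W} {A : Pt d →ᵃ[ℝ] W}
    (hA : Set.EqOn v A (hull T)) {x : Pt d} (hx : x ∈ interior (hull T)) (w : Pt d) :
    fderiv ℝ v x w = A.linear w := by
  have h1 : v =ᶠ[𝓝 x] A :=
    Filter.eventuallyEq_of_mem (mem_interior_iff_mem_nhds.1 hx) hA
  have h2 : HasFDerivAt A (LinearMap.toContinuousLinearMap A.linear) x := by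
    have h3 := (LinearMap.toContinuousLinearMap A.linear).hasFDerivAt (x := x)
    have h4 := h3.add_const (A 0)
    refine h4.congr_of_eventuallyEq (Filter.Eventually.of_forall fun y => ?_)
    have := congrFun A.decomp y
    simpa using this
  rw [h1.fderiv_eq, h2.fderiv]
  rfl

/-- The two affine pieces of `v` agree on the common facet, so their linear parts differ by a
rank-one map that sees only the normal component. -/
lemma linear_sub_eq_inner_smul {M : Mesh d} (hd : 1 ≤ d) {S T F : Finset (Pt d)}
    (hT : T ∈ M.cells) (hFS : F ⊆ S) (hFT : F ⊆ T) (hFc : F.card = d) {n : Pt d}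
    (hn : ‖n‖ = 1) (hF : ∀ x ∈ F, ∀ y ∈ F, inner ℝ n (x - y) = 0) {v : Pt d → W}
    {A B : Pt d →ᵃ[ℝ] W} (hA : Set.EqOn v A (hull S)) (hB : Set.EqOn v B (hull T)) (w : Pt d) :
    (A.linear - B.linear) w = (inner ℝ n w : ℝ) • (A.linear - B.linear) n := by
  refine linear_eq_inner_smul hd hFc ((M.indep T hT).mono (by exact_mod_cast hFT)) hn hF _ ?_ w
  intro x hx y hy
  have h1 : A.linear (x - y) = A x - A y := A.linearMap_vsub x y
  have h2 : B.linear (x - y) = B x - B y := B.linearMap_vsub x y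
  rw [LinearMap.sub_apply, h1, h2, ← hA (mem_hull_self (hFS hx)), ← hA (mem_hull_self (hFS hy)),
    ← hB (mem_hull_self (hFT hx)), ← hB (mem_hull_self (hFT hy)), sub_self]

end Frobenius

/-! ### The three finite element spaces -/

/-- For a continuous piecewise affine `v` the Frobenius norm of the jump of the gradient equals the
norm of the jump of the normal derivative, because the tangential derivatives do not jump. -/
lemma exists_equivWith_gradNormSq {d : ℕ} (hd : 2 ≤ d) (κ : ℝ) (N : ℕ) :
    ∃ C : ℝ, ∀ (M : Mesh d) (Ω : Set (Pt d)) (n : Finset (Pt d) → Pt d), M.ShapeRegular κ →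
      IsOpen Ω → Ω ⊆ M.domain → (∀ T ∈ M.cells, (hull T ∩ Ω).Nonempty) → M.BoundedWalk Ω N →
      M.IsUnitNormalField n → ∀ v : Pt d → Pt d, M.IsP1 v →
      EquivWith C (gradNormSq v M.domain) (gradNormSq v Ω +
        ∑ F ∈ M.cutFacets Ω, M.facetSize F * facetJumpSq F (n F) (normalDeriv (n F) v)) := by
  obtain ⟨C, hC⟩ := exists_equivWith_of_const hd κ N
  refine ⟨C, fun M Ω n hM hΩ hsub hne hwalk hn v hv => ?_⟩
  have hA' : ∀ T, ∃ A : Pt d →ᵃ[ℝ] Pt d, T ∈ M.cells → Set.EqOn v A (hull T) := fun T => by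
    by_cases hT : T ∈ M.cells
    · obtain ⟨A, hA⟩ := hv.2 T hT
      exact ⟨A, fun _ => hA⟩
    · exact ⟨0, fun h => absurd h hT⟩
  choose A hA using hA'
  refine hC M Ω n hM hΩ hsub hne hwalk hn
    (fun x => ∑ i : Fin d, ‖fderiv ℝ v x (EuclideanSpace.single i (1 : ℝ))‖ ^ 2)
    (fun T => frobeniusSq (A T).linear)
    (fun F => facetJumpSq F (n F) (normalDeriv (n F) v))
    (fun x => Finset.sum_nonneg fun _ _ => sq_nonneg _) (fun F => facetJumpSq_nonneg _ _ _)
    (fun T hT => ⟨frobeniusSq_nonneg _, fun x hx => ?_⟩) ?_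
  · exact Finset.sum_congr rfl fun i _ => by rw [fderiv_eq_of_eqOn (hA T hT) hx]
  · intro F hF S hS T hT hFS hFT hST
    have hFc := Mesh.card_of_mem_interiorFacets hF
    obtain ⟨hn1, hn2⟩ := hn F hF
    refine ⟨‖((A S).linear - (A T).linear) (n F)‖ ^ 2, sq_nonneg _, ?_, ?_, ?_⟩
    · exact facetJumpSq_eq (by omega) hS hT hST hFS hFT hFc hn1 hn2
        (fun x hx => fderiv_eq_of_eqOn (hA S hS) hx _)
        (fun x hx => fderiv_eq_of_eqOn (hA T hT) hx _)
    · rw [← frobeniusSq_eq_of_rank_one _ hn1 (linear_sub_eq_inner_smul (by omega) hT hFS hFT hFc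
        hn1 hn2 (hA S hS) (hA T hT))]
      exact frobeniusSq_le_two_mul _ _
    · refine (norm_sub_sq_le_two_mul _ _).trans ?_
      have h1 := norm_apply_sq_le_frobeniusSq (A S).linear hn1
      have h2 := norm_apply_sq_le_frobeniusSq (A T).linear hn1
      linarith

lemma exists_equivWith_normSq_of_isP0 {d : ℕ} (hd : 2 ≤ d) (κ : ℝ) (N : ℕ) :
    ∃ C : ℝ, ∀ (M : Mesh d) (Ω : Set (Pt d)) (n : Finset (Pt d) → Pt d), M.ShapeRegular κ →
      IsOpen Ω → Ω ⊆ M.domain → (∀ T ∈ M.cells, (hull T ∩ Ω).Nonempty) → M.BoundedWalk Ω N →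
      M.IsUnitNormalField n → ∀ q : Pt d → ℝ, M.IsP0 q →
      EquivWith C (normSq q M.domain)
        (normSq q Ω + ∑ F ∈ M.cutFacets Ω, M.facetSize F * facetJumpSq F (n F) q) := by
  obtain ⟨C, hC⟩ := exists_equivWith_of_const hd κ N
  refine ⟨C, fun M Ω n hM hΩ hsub hne hwalk hn q hq => ?_⟩
  have hc' : ∀ T, ∃ c : ℝ, T ∈ M.cells → ∀ x ∈ interior (hull T), q x = c := fun T => by
    by_cases hT : T ∈ M.cells
    · obtain ⟨c, hc⟩ := hq T hT
      exact ⟨c, fun _ => hc⟩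
    · exact ⟨0, fun h => absurd h hT⟩
  choose c hc using hc'
  refine hC M Ω n hM hΩ hsub hne hwalk hn (fun x => q x ^ 2) (fun T => c T ^ 2)
    (fun F => facetJumpSq F (n F) q)
    (fun x => sq_nonneg _) (fun F => facetJumpSq_nonneg _ _ _)
    (fun T hT => ⟨sq_nonneg _, fun x hx => by rw [hc T hT x hx]⟩) ?_
  intro F hF S hS T hT hFS hFT hST
  refine ⟨‖c S - c T‖ ^ 2, sq_nonneg _, ?_, ?_, ?_⟩
  · exact facetJumpSq_eq (by omega) hS hT hST hFS hFT (Mesh.card_of_mem_interiorFacets hF)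
      (hn F hF).1 (hn F hF).2 (hc S hS) (hc T hT)
  · simpa [sq_abs] using norm_sq_le_two_mul (c S) (c T)
  · simpa [sq_abs] using norm_sub_sq_le_two_mul (c S) (c T)

/-- The gradient of an affine function, as a vector. -/
lemma exists_gradient {d : ℕ} (A : Pt d →ᵃ[ℝ] ℝ) : ∃ g : Pt d,
    (∀ w, A.linear w = inner ℝ g w) ∧ ∀ x y, A x = A y + inner ℝ g (x - y) := by
  have h : ∀ w, A.linear w = inner ℝ
      ((InnerProductSpace.toDual ℝ (Pt d)).symm (LinearMap.toContinuousLinearMap A.linear)) w :=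
    fun w => by simp
  refine ⟨_, h, fun x y => ?_⟩
  have h1 : A.linear (x - y) = A x - A y := A.linearMap_vsub x y
  rw [← h, h1]
  ring

/-- Here the density is not constant on the cells: the step from a cell to its neighbour uses the
extension estimate for affine functions, and the bound on the penalty the inverse estimate. The
factor `h_F ^ 3` balances `h_F ^ 2` from the square of the distance to the facet. -/
lemma exists_equivWith_normSq_of_isP1 {d : ℕ} (hd : 2 ≤ d) (κ : ℝ) (N : ℕ) :
    ∃ C : ℝ, ∀ (M : Mesh d) (Ω : Set (Pt d)) (n : Finset (Pt d) → Pt d), M.ShapeRegular κ →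
      IsOpen Ω → Ω ⊆ M.domain → (∀ T ∈ M.cells, (hull T ∩ Ω).Nonempty) → M.BoundedWalk Ω N →
      M.IsUnitNormalField n → ∀ q : Pt d → ℝ, M.IsP1 q →
      EquivWith C (normSq q M.domain) (normSq q Ω +
        ∑ F ∈ M.cutFacets Ω, M.facetSize F ^ 3 * facetJumpSq F (n F) (normalDeriv (n F) q)) := by
  obtain ⟨C, hC1, hC⟩ := exists_sizeBounds hd κ
  set K := max κ 1
  have hK0 : 0 ≤ K := zero_le_one.trans (le_max_right _ _)
  set C1 := 16 * K ^ 4 * C * K ^ d * 4 ^ d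
  set C2 := 4 * K ^ 2 * K ^ d * 4 ^ d
  have h1 : 0 ≤ C1 := by positivity
  have h2 : 0 ≤ C2 := by positivity
  have h3 : 0 ≤ C ^ 3 := by positivity
  have h4 : 0 ≤ C ^ 3 * C2 := by positivity
  refine ⟨walkConst d N (2 * C1 + 2 * C ^ 3 + 2 * (C ^ 3 * C2)), ?_⟩
  intro M Ω n hM hΩ hsub hne hwalk hn q hq
  have hA' : ∀ T, ∃ A : Pt d →ᵃ[ℝ] ℝ, T ∈ M.cells → Set.EqOn q A (hull T) := fun T => by
    by_cases hT : T ∈ M.cells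
    · obtain ⟨A, hA⟩ := hq.2 T hT
      exact ⟨A, fun _ => hA⟩
    · exact ⟨0, fun h => absurd h hT⟩
  choose A hA using hA'
  choose g hg hgA using fun T => exists_gradient (A T)
  have hcont : ∀ T, Continuous fun x => A T x ^ 2 := fun T =>
    (continuous_of_affine (hgA T)).pow 2
  have hsq : ∀ T ∈ M.cells, Set.EqOn (fun x => q x ^ 2) (fun x => A T x ^ 2) (hull T) :=
    fun T hT x hx => by
      change q x ^ 2 = A T x ^ 2
      rw [hA T hT hx]
  have hint : ∀ T ∈ M.cells, ∫ x in hull T, q x ^ 2 = ∫ x in hull T, A T x ^ 2 := fun T hT =>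
    setIntegral_congr_fun (measurableSet_hull T) (hsq T hT)
  have hjump : ∀ F ∈ M.interiorFacets, ∀ S ∈ M.cells, ∀ T ∈ M.cells, F ⊆ S → F ⊆ T → S ≠ T →
      facetJumpSq F (n F) (normalDeriv (n F) q) =
        ‖(A S).linear (n F) - (A T).linear (n F)‖ ^ 2 * facetArea F := by
    intro F hF S hS T hT hFS hFT hST
    exact facetJumpSq_eq (by omega) hS hT hST hFS hFT (Mesh.card_of_mem_interiorFacets hF)
      (hn F hF).1 (hn F hF).2
      (fun x hx => fderiv_eq_of_eqOn (hA S hS) hx _) (fun x hx => fderiv_eq_of_eqOn (hA T hT) hx _)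
  refine hwalk.equivWith hΩ hsub hne (f := fun x => q x ^ 2)
    (j := fun F => M.facetSize F ^ 3 * facetJumpSq F (n F) (normalDeriv (n F) q))
    (K := 2 * C1 + 2 * C ^ 3 + 2 * (C ^ 3 * C2)) (fun x => sq_nonneg _)
    (fun T hT => (integrableOn_hull_of_continuous (hcont T) T).congr_fun (hsq T hT).symm
      (measurableSet_hull T))
    (fun F _ => mul_nonneg (pow_nonneg (facetSize_nonneg M F) 3) (facetJumpSq_nonneg _ _ _))
    (by linarith) ?_ ?_
  · intro F hF S hS T hT hFS hFT hST
    have hFc := Mesh.card_of_mem_interiorFacets hF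
    obtain ⟨hn1, hn2⟩ := hn F hF
    have hb := hC M hM S T F hS hT hST hFS hFT hF (n F) hn1 hn2
    obtain ⟨cS, ρS, hinS⟩ := hM.exists_isInscribed hd hS
    obtain ⟨cT, ρT, hinT⟩ := hM.exists_isInscribed hd hT
    obtain ⟨p, hp⟩ := Finset.card_pos.1 (by omega : 0 < F.card)
    rw [hjump F hF S hS T hT hFS hFT hST, hint S hS, hint T hT]
    set δ := (A S).linear (n F) - (A T).linear (n F) with hδ
    -- on `S`, the function differs from the extension of its restriction to `T` by the normal
    -- jump times the distance to the facet
    have hpt : ∀ x ∈ hull S,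
        A S x ^ 2 ≤ 2 * A T x ^ 2 + 2 * (‖δ‖ ^ 2 * Metric.diam (hull S) ^ 2) := by
      intro x hx
      have e1 := linear_sub_eq_inner_smul (by omega) hT hFS hFT hFc hn1 hn2 (hA S hS) (hA T hT)
        (x - p)
      have e2 : (A S).linear (x - p) = A S x - A S p := (A S).linearMap_vsub x p
      have e3 : (A T).linear (x - p) = A T x - A T p := (A T).linearMap_vsub x p
      have e4 : A S p = A T p := by
        rw [← hA S hS (mem_hull_self (hFS hp)), ← hA T hT (mem_hull_self (hFT hp))]
      have e5 : A S x - A T x = inner ℝ (n F) (x - p) * δ := by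
        rw [LinearMap.sub_apply, LinearMap.sub_apply, e2, e3, e4, smul_eq_mul, ← hδ] at e1
        linarith
      have e6 : |inner ℝ (n F) (x - p)| ≤ Metric.diam (hull S) := by
        refine (abs_real_inner_le_norm _ _).trans ?_
        rw [hn1, one_mul, ← dist_eq_norm]
        exact Metric.dist_le_diam_of_mem (isCompact_hull S).isBounded hx (mem_hull_self (hFS hp))
      have e7 : ‖A S x - A T x‖ ^ 2 ≤ ‖δ‖ ^ 2 * Metric.diam (hull S) ^ 2 := by
        rw [e5, norm_mul, mul_pow, mul_comm]
        gcongr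
        exact e6
      have e8 := norm_sq_le_two_mul (A S x) (A T x)
      simp only [Real.norm_eq_abs, sq_abs] at e8 e7 ⊢
      linarith
    have hJ : 0 ≤ M.facetSize F ^ 3 * (‖δ‖ ^ 2 * facetArea F) :=
      mul_nonneg (pow_nonneg (facetSize_nonneg M F) 3)
        (mul_nonneg (sq_nonneg _) (facetArea_nonneg F))
    have hI : 0 ≤ ∫ x in hull T, A T x ^ 2 := integral_nonneg fun x => sq_nonneg _
    have hext := setIntegral_sq_le_of_affine (hgA T) hinT
      (diam_le_of_common_facet hd hS hFS hFT hFc hinS)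
      ⟨p, mem_hull_self (hFS hp), mem_hull_self (hFT hp)⟩ (by linarith) hb.vol_le_vol
    have hiT := integrableOn_hull_of_continuous (hcont T) S
    have hstep1 : ∫ x in hull S, A S x ^ 2 ≤ 2 * (∫ x in hull S, A T x ^ 2) +
        2 * (‖δ‖ ^ 2 * Metric.diam (hull S) ^ 2) * cellVol S := by
      calc ∫ x in hull S, A S x ^ 2
          ≤ ∫ x in hull S, (2 * A T x ^ 2 + 2 * (‖δ‖ ^ 2 * Metric.diam (hull S) ^ 2)) :=
            setIntegral_mono_on (integrableOn_hull_of_continuous (hcont S) S)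
              (integrableOn_hull_of_continuous (((hcont T).const_mul 2).add continuous_const) S)
              (measurableSet_hull S) hpt
        _ = _ := by
            rw [integral_add (hiT.const_mul 2) (integrableOn_const (volume_hull_ne_top S)),
              integral_const_mul, setIntegral_const, smul_eq_mul, cellVol]
            ring
    have hstep2 : 2 * (‖δ‖ ^ 2 * Metric.diam (hull S) ^ 2) * cellVol S ≤
        2 * C ^ 3 * (M.facetSize F ^ 3 * (‖δ‖ ^ 2 * facetArea F)) := by
      calc 2 * (‖δ‖ ^ 2 * Metric.diam (hull S) ^ 2) * cellVol S
          ≤ 2 * (‖δ‖ ^ 2 * (C * M.facetSize F) ^ 2) * (C * (M.facetSize F * facetArea F)) := by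
            have := hb.diam_le
            have := hb.vol_le
            have := Metric.diam_nonneg (s := hull S)
            have := cellVol_nonneg S
            gcongr
        _ = _ := by ring
    have h5 := mul_nonneg h1 hJ
    have h6 := mul_nonneg h3 hI
    have h7 := mul_nonneg h4 (add_nonneg hI hJ)
    linarith
  · intro F hF S hS T hT hFS hFT hST
    obtain ⟨hn1, hn2⟩ := hn F hF
    rw [hjump F hF S hS T hT hFS hFT hST, hint S hS, hint T hT]
    have key : ∀ S ∈ M.cells, ∀ T ∈ M.cells, F ⊆ S → F ⊆ T → S ≠ T →
        M.facetSize F ^ 3 * facetArea F * ‖(A S).linear (n F)‖ ^ 2 ≤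
          C ^ 3 * C2 * ∫ x in hull S, A S x ^ 2 := by
      intro S hS T hT hFS hFT hST
      have hb := hC M hM S T F hS hT hST hFS hFT hF (n F) hn1 hn2
      obtain ⟨cS, ρS, hinS⟩ := hM.exists_isInscribed hd hS
      have e1 := norm_sq_mul_le_setIntegral (hgA S) hinS
      have e2 : ‖(A S).linear (n F)‖ ≤ ‖g S‖ := by
        rw [hg S, Real.norm_eq_abs]
        refine (abs_real_inner_le_norm _ _).trans ?_
        rw [hn1, mul_one]
      have hs := facetSize_nonneg M F
      have ha := facetArea_nonneg F
      have hv := cellVol_nonneg S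
      have hd0 := Metric.diam_nonneg (s := hull S)
      calc M.facetSize F ^ 3 * facetArea F * ‖(A S).linear (n F)‖ ^ 2
          = M.facetSize F ^ 2 * (M.facetSize F * facetArea F) * ‖(A S).linear (n F)‖ ^ 2 := by ring
        _ ≤ (C * Metric.diam (hull S)) ^ 2 * (C * cellVol S) * ‖g S‖ ^ 2 := by
            have := hb.facetSize_le
            have := hb.le_vol
            gcongr
        _ = C ^ 3 * (‖g S‖ ^ 2 * (Metric.diam (hull S) ^ 2 * cellVol S)) := by ring
        _ ≤ C ^ 3 * (C2 * ∫ x in hull S, A S x ^ 2) := by gcongr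
        _ = _ := by ring
    have k1 := key S hS T hT hFS hFT hST
    have k2 := key T hT S hS hFT hFS hST.symm
    have hI : 0 ≤ ∫ x in hull T, A T x ^ 2 := integral_nonneg fun x => sq_nonneg _
    have hI' : 0 ≤ ∫ x in hull S, A S x ^ 2 := integral_nonneg fun x => sq_nonneg _
    have h0 : 0 ≤ M.facetSize F ^ 3 * facetArea F :=
      mul_nonneg (pow_nonneg (facetSize_nonneg M F) 3) (facetArea_nonneg F)
    have h5 := mul_le_mul_of_nonneg_left
      (norm_sub_sq_le_two_mul ((A S).linear (n F)) ((A T).linear (n F))) h0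
    have h6 := mul_nonneg h1 (add_nonneg hI' hI)
    have h7 := mul_nonneg h3 (add_nonneg hI' hI)
    linarith

end FictitiousDomain

theorem mainTheorem4 (d : ℕ) (hd : d = 2 ∨ d = 3) (κ : ℝ) (N : ℕ) :
    ∃ C : ℝ, 0 < C ∧
      ∀ (M : FictitiousDomain.Mesh d) (Ω : Set (FictitiousDomain.Pt d))
        (n : Finset (FictitiousDomain.Pt d) → FictitiousDomain.Pt d),
        M.ShapeRegular κ →
        IsOpen Ω →
        Ω ⊆ M.domain →
        (∀ T ∈ M.cells, (FictitiousDomain.hull T ∩ Ω).Nonempty) →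
        M.BoundedWalk Ω N →
        M.IsUnitNormalField n →
        (∀ v : FictitiousDomain.Pt d → FictitiousDomain.Pt d, M.IsP1 v →
          FictitiousDomain.gradNormSq v M.domain ≤
              C * (FictitiousDomain.gradNormSq v Ω +
                ∑ F ∈ M.cutFacets Ω, M.facetSize F *
                  FictitiousDomain.facetJumpSq F (n F) (FictitiousDomain.normalDeriv (n F) v)) ∧
            FictitiousDomain.gradNormSq v Ω +
                ∑ F ∈ M.cutFacets Ω, M.facetSize F *
                  FictitiousDomain.facetJumpSq F (n F) (FictitiousDomain.normalDeriv (n F) v) ≤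
              C * FictitiousDomain.gradNormSq v M.domain) ∧
        (∀ q : FictitiousDomain.Pt d → ℝ, M.IsP0 q →
          FictitiousDomain.normSq q M.domain ≤
              C * (FictitiousDomain.normSq q Ω +
                ∑ F ∈ M.cutFacets Ω, M.facetSize F *
                  FictitiousDomain.facetJumpSq F (n F) q) ∧
            FictitiousDomain.normSq q Ω +
                ∑ F ∈ M.cutFacets Ω, M.facetSize F *
                  FictitiousDomain.facetJumpSq F (n F) q ≤
              C * FictitiousDomain.normSq q M.domain) ∧
        (∀ q : FictitiousDomain.Pt d → ℝ, M.IsP1 q →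
          FictitiousDomain.normSq q M.domain ≤
              C * (FictitiousDomain.normSq q Ω +
                ∑ F ∈ M.cutFacets Ω, M.facetSize F ^ 3 *
                  FictitiousDomain.facetJumpSq F (n F) (FictitiousDomain.normalDeriv (n F) q)) ∧
            FictitiousDomain.normSq q Ω +
                ∑ F ∈ M.cutFacets Ω, M.facetSize F ^ 3 *
                  FictitiousDomain.facetJumpSq F (n F) (FictitiousDomain.normalDeriv (n F) q) ≤
              C * FictitiousDomain.normSq q M.domain) := by
  have hd2 : 2 ≤ d := by omega
  obtain ⟨C₁, h₁⟩ := FictitiousDomain.exists_equivWith_gradNormSq hd2 κ N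
  obtain ⟨C₂, h₂⟩ := FictitiousDomain.exists_equivWith_normSq_of_isP0 hd2 κ N
  obtain ⟨C₃, h₃⟩ := FictitiousDomain.exists_equivWith_normSq_of_isP1 hd2 κ N
  refine ⟨max 1 (max C₁ (max C₂ C₃)), lt_max_of_lt_left one_pos, ?_⟩
  intro M Ω n hM hΩ hsub hne hwalk hn
  exact ⟨fun v hv => ((h₁ M Ω n hM hΩ hsub hne hwalk hn v hv).mono (by simp)).2.2,
    fun q hq => ((h₂ M Ω n hM hΩ hsub hne hwalk hn q hq).mono (by simp)).2.2,
    fun q hq => ((h₃ M Ω n hM hΩ hsub hne hwalk hn q hq).mono (by simp)).2.2⟩
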